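/- **Conventions.** Let $\mathbb T$ be the unit circle with normalised Lebesgue measure, $\mathbb D$ the open unit disc and $\mathbb D^*=\{|z|>1\}\cup\{\infty\}$. Functions on $\mathbb T$ are identified when equal almost everywhere, and $f^*=\overline f$ on $\mathbb T$. Let $H^2(\mathbb D)$ be the space of $f\in L^2(\mathbb T)$ whose Fourier coefficients $\hat f(n)$ vanish for $n<0$; such $f$ extends analytically to $\mathbb D$ by $f(z)=\sum_{n\ge 0}\hat f(n)z^n$. Let $H^2(\mathbb D^*)=\{f: f^*\in H^2(\mathbb D)\}$; such $f$ extends to $\mathbb D^*$ by $f(z)=\overline{f^*(1/\overline z)}$, $f(\infty)=\overline{f^*(0)}$. Let $P_{\mathbb D}$ be the orthogonal projection of $L^2(\mathbb T)$ onto $H^2(\mathbb D)$. A function $g\in H^2(\mathbb D)$ is inner if $|g|=1$ a.e. on $\mathbb T$. A pair $(a,b)$ is identified with the matrix function $\begin{pmatrix} a & b\\ -b^* & a^*\end{pmatrix}$, so that $(a,b)(c,d)=(ac-bd^*,\,ad+bc^*)$. * $\mathbf L$ is the set of pairs $(a,b)$ of measurable functions on $\mathbb T$ with $aa^*+bb^*=1$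 a.e., $a\in H^2(\mathbb D^*)$ and $a(\infty)>0$, with the metric $\rho((a,b),(c,d))=\|a-c\|_{L^2(\mathbb T)}+\|b-d\|_{L^2(\mathbb T)}+|\log a(\infty)-\log c(\infty)|$. * $\mathbf H$ is the set of $(a,b)\in\mathbf L$ with $b\in H^2(\mathbb D)$ such that every inner $g$ with $a^*g^{-1},\,bg^{-1}\in H^2(\mathbb D)$ is constant. * $\mathbf H_0^*$ is the set of $(a,b)\in\mathbf L$ with $(a,b^*)\in\mathbf H$ and $b^*(0)=0$. * $\mathbf B$ is the set of $(a,b)\in\mathbf L$ with $\inf_{z\in\mathbb D^*}|a(z)|^2>\tfrac12$. For $F\in\ell^2(\mathbb Z)$ and integers $M\le N$ let $G_{M,N}$ be the product, ordered from left to right with increasing $k$, of the factors $(1+|F_k|^2)^{-1/2}(1,F_kz^k)$, $M\le k\le N$. The $SU(2)$ nonlinear Fourier series of $F$ is the product $(a_-,b_-)(a_+,b_+)$, where $(a_+,b_+)$ is the limit of $G_{0,n}$ and $(a_-,b_-)$ the limit of $G_{-n,-1}$ in $\mathbf L$ as $n\to\infty$. **Theorem.** Let $(a,b)\in\mathbf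 B$. 1. There are unique $(a_-,b_-)\in\mathbf H_0^*$ and $(a_+,b_+)\in\mathbf H$ with $$(a_-,b_-)(a_+,b_+)=(a,b)\quad\text{almost everywhere on }\mathbb T.$$ 2. We have $\operatorname{ess\,sup}_{\mathbb T}|b/a|<1$, and the map $$(A,B)\mapsto\Big(\big(1-P_{\mathbb D}(\tfrac ba B^*)\big)^*,\;P_{\mathbb D}(\tfrac ba A)\Big)$$ is a contraction on $L^2(\mathbb T)\oplus L^2(\mathbb T)$. Its unique fixed point $(A,B)$ satisfies $A(\infty)>0$, and the factors in 1 are $(a_+,b_+)=A(\infty)^{-1/2}(A,B)$ and $(a_-,b_-)=(a,b)(a_+^*,-b_+)$. 3. There is a unique $F\in\ell^2(\mathbb Z)$ whose $SU(2)$ nonlinear Fourier series is $(a,b)$. -/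

import Mathlib

open MeasureTheory Filter Topology AddCircle
open scoped ENNReal NNReal ComplexConjugate

noncomputable section

namespace NLFS

/-- The unit circle `𝕋`, parametrised by `θ ∈ ℝ/ℤ` through `z = e^{2πiθ}`, so that
`fourier n` is the monomial `zⁿ` and `fourierCoeff f n` is the coefficient of `zⁿ`. -/
abbrev Circ : Type := UnitAddCircle

/-- Normalised Lebesgue measure on the circle (total mass one). -/
abbrev circMeas : Measure Circ := haarAddCircle

/-- The Hilbert space `L²(𝕋)`; its elements are functions modulo equality almost everywhere.
`star f` is the pointwise complex conjugate, which on the circle is `f^*`. -/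
abbrev L2T : Type := Lp ℂ 2 circMeas

/-- A pair `(a, b)`, standing for the matrix function with rows `(a, b)`, `(-b^*, a^*)`. -/
abbrev FunPair : Type := L2T × L2T

/-- The first row of the product of the matrices with rows `(a, b)`, `(-b^*, a^*)` and
`(c, d)`, `(-d^*, c^*)`, namely `(a, b)(c, d) = (a c - b d^*, a d + b c^*)`. -/
def mulSU2 {R : Type*} [CommRing R] [StarRing R] (p q : R × R) : R × R :=
  (p.1 * q.1 - p.2 * star q.2, p.1 * q.2 + p.2 * star q.1)

/-! ### Hardy spaces -/

/-- `f ∈ H²(𝔻)`: `f` is in `L²(𝕋)` and its Fourier coefficients are supported on `[0, ∞)`. -/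
def MemHardy (f : Circ → ℂ) : Prop :=
  MemLp f 2 circMeas ∧ ∀ n : ℤ, n < 0 → fourierCoeff f n = 0

/-- `f ∈ H²(𝔻^*)`: the function `f^*` is in `H²(𝔻)`. -/
def MemHardyStar (f : Circ → ℂ) : Prop :=
  MemHardy (star f)

/-- The value at `w` in the open unit disc `𝔻` of the analytic extension of `f ∈ H²(𝔻)`. -/
def discVal (f : Circ → ℂ) (w : ℂ) : ℂ :=
  ∑' n : ℕ, fourierCoeff f n * w ^ n

/-- The reflected disc `𝔻^* = {|z| > 1} ∪ {∞}` in the Riemann sphere. -/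
def discStar : Set (OnePoint ℂ) :=
  {OnePoint.infty} ∪ (fun z : ℂ => (z : OnePoint ℂ)) '' {z : ℂ | 1 < ‖z‖}

/-- The value at a point of `𝔻^*` of the analytic extension of `f ∈ H²(𝔻^*)`, that is
`f(z) = conj (f^*(1 / conj z))` and `f(∞) = conj (f^*(0))`. -/
def discStarVal (f : Circ → ℂ) : OnePoint ℂ → ℂ
  | none => conj (discVal (star f) 0)
  | some z => conj (discVal (star f) (conj z)⁻¹)

/-- `f(∞)` for `f ∈ H²(𝔻^*)`. -/
def valInfty (f : Circ → ℂ) : ℂ :=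
  discStarVal f OnePoint.infty

/-- `f(∞) > 0`: the value at infinity is real and positive. -/
def PosAtInfty (f : Circ → ℂ) : Prop :=
  (valInfty f).im = 0 ∧ 0 < (valInfty f).re

/-- Inner functions on the circle. -/
def IsInner (g : Circ → ℂ) : Prop :=
  MemHardy g ∧ ∀ᵐ t ∂circMeas, ‖g t‖ = 1

/-- `u` and `v` have no common inner factor: every inner `g` with `u g⁻¹` and `v g⁻¹`
in `H²(𝔻)` is constant. -/
def NoCommonInnerFactor (u v : Circ → ℂ) : Prop :=
  ∀ g : Circ → ℂ, IsInner g →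
    MemHardy (fun t => u t * (g t)⁻¹) → MemHardy (fun t => v t * (g t)⁻¹) →
    ∃ c : ℂ, ∀ᵐ t ∂circMeas, g t = c

/-! ### The spaces of pairs -/

/-- The space `𝐋` of pairs with `a a^* + b b^* = 1` almost everywhere, `a ∈ H²(𝔻^*)` and
`a(∞) > 0`. (Measurable functions with the first property are bounded by one, hence in `L²`.) -/
def spaceL : Set FunPair :=
  {p | (∀ᵐ t ∂circMeas, p.1 t * star (p.1 t) + p.2 t * star (p.2 t) = 1) ∧
    MemHardyStar p.1 ∧ PosAtInfty p.1}

/-- The metric of `𝐋`. -/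
def rho (p q : FunPair) : ℝ :=
  ‖p.1 - q.1‖ + ‖p.2 - q.2‖ + |Real.log (valInfty p.1).re - Real.log (valInfty q.1).re|

/-- The space `𝐇`: elements of `𝐋` with `b ∈ H²(𝔻)` such that `a^*` and `b` have no common
inner factor. -/
def spaceH : Set FunPair :=
  {p | p ∈ spaceL ∧ MemHardy p.2 ∧ NoCommonInnerFactor (star p.1) p.2}

/-- The space `𝐇₀^*`: elements of `𝐋` with `(a, b^*) ∈ 𝐇` and `b^*(0) = 0`. -/
def spaceH0Star : Set FunPair :=
  {p | p ∈ spaceL ∧ (p.1, star p.2) ∈ spaceH ∧ discVal (star p.2) 0 = 0}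

/-- The space `𝐁`: elements of `𝐋` with `inf_{z ∈ 𝔻^*} |a(z)|² > 1/2`. -/
def spaceB : Set FunPair :=
  {p | p ∈ spaceL ∧ 1 / 2 < sInf ((fun z => ‖discStarVal p.1 z‖ ^ 2) '' discStar)}

/-- The product relation `p q = r` for pairs, almost everywhere on the circle. -/
def IsProd (p q r : FunPair) : Prop :=
  ∀ᵐ t ∂circMeas, mulSU2 (p.1 t, p.2 t) (q.1 t, q.2 t) = (r.1 t, r.2 t)

/-! ### Nonlinear Fourier series -/

/-- The elementary factor `(1 + |F_k|²)^{-1/2} (1, F_k z^k)`. -/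
def factor (F : ℤ → ℂ) (k : ℤ) : C(Circ, ℂ) × C(Circ, ℂ) :=
  ((((Real.sqrt (1 + ‖F k‖ ^ 2))⁻¹ : ℝ) : ℂ)) • ((1, F k • fourier k) : C(Circ, ℂ) × C(Circ, ℂ))

/-- The ordered product of the factors with index `M, M + 1, …, M + n - 1` (from left to right):
the nonlinear Fourier series of the restriction of `F` to this interval. -/
def partialProd (F : ℤ → ℂ) (M : ℤ) : ℕ → C(Circ, ℂ) × C(Circ, ℂ)
  | 0 => (1, 0)
  | n + 1 => mulSU2 (partialProd F M n) (factor F (M + n))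

/-- A pair of continuous functions as a pair of elements of `L²(𝕋)`. -/
def toFunPair (p : C(Circ, ℂ) × C(Circ, ℂ)) : FunPair :=
  (ContinuousMap.toLp 2 circMeas ℂ p.1, ContinuousMap.toLp 2 circMeas ℂ p.2)

/-- `p` is the nonlinear Fourier series of the part of `F` on `[0, ∞)`: the limit in `𝐋` of
the series of the truncations to `[0, n)`. -/
def IsRightSeries (F : ℤ → ℂ) (p : FunPair) : Prop :=
  p ∈ spaceL ∧
    Tendsto (fun n : ℕ => rho (toFunPair (partialProd F 0 n)) p) atTop (𝓝 0)

/-- `p` is the nonlinear Fourier series of the part of `F` on `(-∞, -1]`: the limit in `𝐋` of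
the series of the truncations to `[-n, -1]`. -/
def IsLeftSeries (F : ℤ → ℂ) (p : FunPair) : Prop :=
  p ∈ spaceL ∧
    Tendsto (fun n : ℕ => rho (toFunPair (partialProd F (-(n : ℤ)) n)) p) atTop (𝓝 0)

/-- `p` is the `SU(2)` nonlinear Fourier series of the square summable sequence `F`: the product
`(a_-, b_-)(a_+, b_+)` of the series of its parts on `(-∞, -1]` and on `[0, ∞)`. -/
def IsNonlinearFourierSeries (F : lp (fun _ : ℤ => ℂ) 2) (p : FunPair) : Prop :=
  ∃ pm pp : FunPair, IsLeftSeries F pm ∧ IsRightSeries F pp ∧ IsProd pm pp p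

/-! ### The Cauchy projection and the fixed point map -/

/-- `H²(𝔻)` as a subspace of `L²(𝕋)`. -/
def hardySubmodule : Submodule ℂ L2T where
  carrier := {f | MemHardy f}
  zero_mem' := by
    refine ⟨Lp.memLp _, fun n _ => ?_⟩
    rw [← fourierBasis_repr]
    simp
  add_mem' := by
    rintro f g ⟨-, hf⟩ ⟨-, hg⟩
    refine ⟨Lp.memLp _, fun n hn => ?_⟩
    have h1 := hf n hn
    have h2 := hg n hn
    rw [← fourierBasis_repr] at h1 h2 ⊢
    rw [map_add, lp.coeFn_add, Pi.add_apply, h1, h2, add_zero]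
  smul_mem' := by
    rintro c f ⟨-, hf⟩
    refine ⟨Lp.memLp _, fun n hn => ?_⟩
    have h1 := hf n hn
    rw [← fourierBasis_repr] at h1 ⊢
    rw [map_smul, lp.coeFn_smul, Pi.smul_apply, h1, smul_zero]

theorem isClosed_hardySubmodule : IsClosed (hardySubmodule : Set L2T) := by
  have h : (hardySubmodule : Set L2T) =
      ⋂ n : ℤ, ⋂ _ : n < 0, {f : L2T | fourierBasis.repr f n = 0} := by
    ext f
    simp only [Set.mem_iInter, Set.mem_ofPred_eq, fourierBasis_repr]
    exact ⟨fun hf => hf.2, fun hf => ⟨Lp.memLp _, hf⟩⟩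
  rw [h]
  refine isClosed_iInter fun n => isClosed_iInter fun _ => ?_
  have hc : Continuous fun f : L2T => fourierBasis.repr f n := by
    have : (fun f : L2T => fourierBasis.repr f n) =
        fun f : L2T => inner ℂ (fourierBasis n) f := by
      funext f
      exact fourierBasis.repr_apply_apply f n
    rw [this]
    fun_prop
  exact isClosed_eq hc continuous_const

instance : CompleteSpace hardySubmodule :=
  isClosed_hardySubmodule.completeSpace_coe

/-- The Cauchy projection `P_𝔻`: the orthogonal projection of `L²(𝕋)` onto `H²(𝔻)`. -/
def cauchyProj : L2T →L[ℂ] L2T :=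
  hardySubmodule.starProjection

open Classical in
/-- The product `m f` of a function `m` with `f ∈ L²(𝕋)`, as an element of `L²(𝕋)`
(with value zero if the product is not in `L²`, which never happens for bounded measurable `m`). -/
def mulL2 (m : Circ → ℂ) (f : L2T) : L2T :=
  if h : MemLp (fun t => m t * f t) 2 circMeas then h.toLp else 0

/-- The Hilbert space `𝓗 = L²(𝕋) ⊕ L²(𝕋)` with the norm `(‖A‖² + ‖B‖²)^{1/2}`. -/
abbrev HilbPair : Type := WithLp 2 (L2T × L2T)

/-- The map `(A, B) ↦ ((1 - P_𝔻((b/a) B^*))^*, P_𝔻((b/a) A))` on `𝓗`. -/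
def fixedPointMap (a b : L2T) (X : HilbPair) : HilbPair :=
  WithLp.toLp 2
    (star (ContinuousMap.toLp 2 circMeas ℂ (1 : C(Circ, ℂ)) -
        cauchyProj (mulL2 (fun t => b t / a t) (star X.snd))),
      cauchyProj (mulL2 (fun t => b t / a t) X.fst))

end NLFS

end

open NLFS

namespace NLFS

/-! ### Fourier coefficients -/

/-! Multiplying `(a_-, b_-)(a_+, b_+) = (a, b)` on the right by the inverse of the right factor
gives `a_- = a a_+^* + b b_+^*` and `b_- = b a_+ - a b_+`. The lower bound on `|a|` in `𝔻^*` makes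
`1/a^*` an element of `H²(𝔻)` (`inv_memHardy`), so dividing by `a` loses nothing: a factorization
says that `a_+^* + (b/a) b_+^*` is the conjugate of an `H²(𝔻)` function and `b_+ - (b/a) a_+` the
conjugate of one vanishing at `0`. After scaling by `a_+(∞)` the first function has value `1` at
`∞`, and these are exactly the fixed point equations for `(A, B) = a_+(∞) (a_+, b_+)`
(`IsFactorization.fixedEqs`, `IsBPair.fixedPointMap_eq_iff`). On the circle `|a|² ≥ c > 1/2` and
`|a|² + |b|² = 1`, whence `|b/a| ≤ s < 1` and the map is a contraction. This gives uniqueness.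

For existence, at a fixed point `|A|² + |B|²` is a real function with Fourier support in `[0, ∞)`,
hence the constant `A(∞)`, which is positive (`FixedEqs.norm_sq_add`, `FixedEqs.posAtInfty`).
Dividing by its square root gives the right factor. The conditions on inner factors are automatic:
`a^* = a_-^* a_+^* - b_-^* b_+` is a Bezout identity with invertible left side
(`noCommonInnerFactor_of_bezout`).

For the sequence, an element of `𝐇` is expanded by layer stripping: factors are removed from the
left, each chosen to kill the lowest coefficient of `b`. The values `a(∞)` of the remaining layers
increase and stay at most `1`, which gives square summability. The layers converge in `L²` to some
`(s, 0)` with `|s| = 1`; then `s^*` is a common inner factor of `a^*` and `b`, hence constant, and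
the values tend to `1` (`tendsto_layer_value`). The squared `L²` distance from a partial product to
the pair is `2 - 2 a(∞)`, with `a` taken from the remaining layer, so the series converges.
Coefficients are recovered recursively from the sum (`IsRightSeries.coeff_eq`). The left half
reduces to the right half through the anti-automorphism `(a, b) ↦ (a, b^*)`. Since the limits of the
two halves satisfy the support conditions, uniqueness of the factorization carries over to the
sequence. -/

theorem norm_fourier_apply (n : ℤ) (t : Circ) : ‖fourier n t‖ = 1 :=
  Circle.norm_coe _

theorem fourierCoeff_star (f : Circ → ℂ) (n : ℤ) :
    fourierCoeff (star f) n = conj (fourierCoeff f (-n)) := by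
  simp only [fourierCoeff, ← integral_conj, smul_eq_mul, map_mul, neg_neg, Pi.star_apply,
    ← fourier_neg, RCLike.star_def]

theorem fourierCoeff_zero_star (f : Circ → ℂ) :
    fourierCoeff (star f) 0 = conj (fourierCoeff f 0) := by
  simpa using fourierCoeff_star f 0

theorem fourierCoeff_fourier_mul (f : Circ → ℂ) (m n : ℤ) :
    fourierCoeff (fun t => fourier m t * f t) n = fourierCoeff f (n - m) := by
  simp only [fourierCoeff, smul_eq_mul, ← mul_assoc, ← fourier_add]
  congr! 4
  ring_nf

theorem fourierCoeff_add {f g : Circ → ℂ} (hf : MemLp f 2 circMeas) (hg : MemLp g 2 circMeas)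
    (n : ℤ) : fourierCoeff (fun t => f t + g t) n = fourierCoeff f n + fourierCoeff g n :=
  congrFun (fourierCoeff.add (hf.integrable one_le_two) (hg.integrable one_le_two)) n

theorem fourierCoeff_neg (f : Circ → ℂ) (n : ℤ) :
    fourierCoeff (fun t => -f t) n = -fourierCoeff f n := by
  simp [fourierCoeff, integral_neg]

theorem fourierCoeff_sub {f g : Circ → ℂ} (hf : MemLp f 2 circMeas) (hg : MemLp g 2 circMeas)
    (n : ℤ) : fourierCoeff (fun t => f t - g t) n = fourierCoeff f n - fourierCoeff g n := by
  simp only [sub_eq_add_neg]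
  rw [fourierCoeff_add hf (g := fun t => -g t) hg.neg, fourierCoeff_neg]

theorem fourierCoeff_const (c : ℂ) (n : ℤ) :
    fourierCoeff (fun _ : Circ => c) n = if n = 0 then c else 0 := by
  have h : (fun _ : Circ => c) = fun t => c * fourier 0 t := by simp
  rw [h, fourierCoeff.const_mul, fourierCoeff_fourier]
  simp [Pi.single_apply]

theorem norm_fourierCoeff_le_one {f : Circ → ℂ} (h : ∀ᵐ t ∂circMeas, ‖f t‖ ≤ 1) (n : ℤ) :
    ‖fourierCoeff f n‖ ≤ 1 := by
  have := norm_integral_le_of_norm_le_const (μ := circMeas)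
    (f := fun t : Circ => fourier (-n) t • f t) (C := 1)
    (by filter_upwards [h] with t ht; rwa [norm_smul, norm_fourier_apply, one_mul])
  simpa [fourierCoeff] using this

/-- Parseval's identity for `f` against `zⁿ g^*`. The product itself is only in `L¹`, but its
coefficients are still the convolution. -/
theorem hasSum_fourierCoeff_mul {f g : Circ → ℂ} (hf : MemLp f 2 circMeas)
    (hg : MemLp g 2 circMeas) (n : ℤ) :
    HasSum (fun k => fourierCoeff f k * fourierCoeff g (n - k))
      (fourierCoeff (fun t => f t * g t) n) := by
  have hx : MemLp (fun t => fourier n t * star (g t)) 2 circMeas := by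
    refine MemLp.of_le hg.star (((map_continuous (fourier n)).aestronglyMeasurable).mul
      hg.star.1) (ae_of_all _ fun t => ?_)
    rw [norm_mul, norm_fourier_apply, one_mul]
    exact le_rfl
  have key := (fourierBasis (T := 1)).hasSum_inner_mul_inner (hx.toLp _) (hf.toLp _)
  have e1 : ∀ k, inner ℂ (hx.toLp _) (fourierBasis (T := 1) k) = fourierCoeff g (n - k) := by
    intro k
    rw [← inner_conj_symm, ← HilbertBasis.repr_apply_apply, fourierBasis_repr,
      fourierCoeff_congr_ae hx.coeFn_toLp, fourierCoeff_fourier_mul]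
    have := fourierCoeff_star g (k - n)
    rw [show (fun t => star (g t)) = star g from rfl, this]
    simp
  have e2 : ∀ k, inner ℂ (fourierBasis (T := 1) k) (hf.toLp _) = fourierCoeff f k := by
    intro k
    rw [← HilbertBasis.repr_apply_apply, fourierBasis_repr, fourierCoeff_congr_ae hf.coeFn_toLp]
  have e3 : inner ℂ (hx.toLp _) (hf.toLp _) = fourierCoeff (fun t => f t * g t) n := by
    rw [L2.inner_def, fourierCoeff]
    refine integral_congr_ae ?_
    filter_upwards [hx.coeFn_toLp, hf.coeFn_toLp] with t h1 h2
    rw [h1, h2, RCLike.inner_apply, map_mul, ← fourier_neg]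
    simp only [RCLike.star_def, RCLike.conj_conj, smul_eq_mul]
    ring
  rw [e3] at key
  simp only [e1, e2] at key
  simpa only [mul_comm] using key

/-- `f ∈ L²(𝕋)` with Fourier coefficients supported on `[m, ∞)`. -/
def VanishBelow (m : ℤ) (f : Circ → ℂ) : Prop :=
  MemLp f 2 circMeas ∧ ∀ n : ℤ, n < m → fourierCoeff f n = 0

namespace VanishBelow

variable {m k : ℤ} {f g : Circ → ℂ}

theorem congr (hf : VanishBelow m f) (h : f =ᵐ[circMeas] g) : VanishBelow m g :=
  ⟨hf.1.ae_eq h, fun n hn => by rw [← fourierCoeff_congr_ae h]; exact hf.2 n hn⟩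

theorem mono (hf : VanishBelow m f) (h : k ≤ m) : VanishBelow k f :=
  ⟨hf.1, fun n hn => hf.2 n (hn.trans_le h)⟩

theorem add (hf : VanishBelow m f) (hg : VanishBelow m g) :
    VanishBelow m (fun t => f t + g t) :=
  ⟨hf.1.add hg.1, fun n hn => by rw [fourierCoeff_add hf.1 hg.1, hf.2 n hn, hg.2 n hn, add_zero]⟩

theorem sub (hf : VanishBelow m f) (hg : VanishBelow m g) :
    VanishBelow m (fun t => f t - g t) :=
  ⟨hf.1.sub hg.1, fun n hn => by rw [fourierCoeff_sub hf.1 hg.1, hf.2 n hn, hg.2 n hn, sub_zero]⟩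

theorem const_mul (hf : VanishBelow m f) (c : ℂ) : VanishBelow m (fun t => c * f t) :=
  ⟨hf.1.const_mul c, fun n hn => by rw [fourierCoeff.const_mul, hf.2 n hn, mul_zero]⟩

theorem const (c : ℂ) : VanishBelow 0 (fun _ => c) :=
  ⟨memLp_const c, fun n hn => by rw [fourierCoeff_const, if_neg hn.ne]⟩

theorem succ (hf : VanishBelow m f) (h : fourierCoeff f m = 0) : VanishBelow (m + 1) f :=
  ⟨hf.1, fun n hn => by
    rcases (Int.lt_add_one_iff.mp hn).lt_or_eq with h1 | rfl
    exacts [hf.2 n h1, h]⟩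

theorem fourier_mul (hf : VanishBelow m f) (j : ℤ) :
    VanishBelow (m + j) (fun t => fourier j t * f t) :=
  ⟨MemLp.of_le hf.1 (((map_continuous (fourier j)).aestronglyMeasurable).mul hf.1.1)
    (ae_of_all _ fun t => by rw [norm_mul, norm_fourier_apply, one_mul]),
    fun n hn => by rw [fourierCoeff_fourier_mul]; exact hf.2 _ (by omega)⟩

theorem fourierCoeff_mul_of_lt (hf : VanishBelow m f) (hg : VanishBelow k g) {n : ℤ}
    (hn : n < m + k) : fourierCoeff (fun t => f t * g t) n = 0 := by
  refine (hasSum_fourierCoeff_mul hf.1 hg.1 n).unique ?_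
  convert hasSum_zero with j
  rcases lt_or_ge j m with h | h
  · rw [hf.2 j h, zero_mul]
  · rw [hg.2 _ (by omega), mul_zero]

theorem fourierCoeff_mul (hf : VanishBelow m f) (hg : VanishBelow k g) :
    fourierCoeff (fun t => f t * g t) (m + k) = fourierCoeff f m * fourierCoeff g k := by
  refine (hasSum_fourierCoeff_mul hf.1 hg.1 _).unique ?_
  have := hasSum_single (f := fun j => fourierCoeff f j * fourierCoeff g (m + k - j)) m
    (fun j hj => by
      rcases hj.lt_or_gt with h | h
      · rw [hf.2 j h, zero_mul]
      · rw [hg.2 _ (by omega), mul_zero])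
  simpa using this

theorem mul (hf : VanishBelow m f) (hg : VanishBelow k g)
    (h : MemLp (fun t => f t * g t) 2 circMeas) : VanishBelow (m + k) (fun t => f t * g t) :=
  ⟨h, fun _ hn => hf.fourierCoeff_mul_of_lt hg hn⟩

end VanishBelow

/-- The product of a bounded and a square integrable function. -/
theorem memLp_bdd_mul {f g : Circ → ℂ} {C : ℝ} (hf : AEStronglyMeasurable f circMeas)
    (h : ∀ᵐ t ∂circMeas, ‖f t‖ ≤ C) (hg : MemLp g 2 circMeas) :
    MemLp (fun t => f t * g t) 2 circMeas := by
  refine MemLp.of_le_mul (c := C) hg (hf.mul hg.1) ?_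
  filter_upwards [h] with t ht
  rw [norm_mul]
  gcongr

/-- An integrable function with vanishing Fourier coefficients vanishes. -/
theorem ae_eq_zero_of_fourierCoeff_eq_zero {f : Circ → ℂ} (hf : Integrable f circMeas)
    (h : ∀ n, fourierCoeff f n = 0) : f =ᵐ[circMeas] 0 := by
  have hint : ∀ φ : C(Circ, ℂ), Integrable (fun t => φ t * f t) circMeas := fun φ =>
    hf.bdd_mul (c := ‖φ‖) (map_continuous φ).aestronglyMeasurable
      (ae_of_all _ fun t => φ.norm_coe_le_norm t)
  let Λ : C(Circ, ℂ) →ₗ[ℂ] ℂ :=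
    { toFun := fun φ => ∫ t, φ t * f t ∂circMeas
      map_add' := fun φ ψ => by
        simp only [ContinuousMap.add_apply, add_mul]
        exact integral_add (hint φ) (hint ψ)
      map_smul' := fun c φ => by
        simp only [ContinuousMap.smul_apply, smul_eq_mul, mul_assoc, RingHom.id_apply]
        exact integral_const_mul c _ }
  let Λ' : C(Circ, ℂ) →L[ℂ] ℂ := Λ.mkContinuous (∫ t, ‖f t‖ ∂circMeas) fun φ => by
    refine (norm_integral_le_integral_norm _).trans ?_
    rw [mul_comm, ← integral_const_mul]
    refine integral_mono (hint φ).norm (hf.norm.const_mul _) fun t => ?_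
    simp only [norm_mul]
    gcongr
    exact φ.norm_coe_le_norm t
  have hΛ' : ∀ φ, Λ' φ = ∫ t, φ t * f t ∂circMeas := fun _ => rfl
  -- The functional kills all monomials, whose span is dense in the continuous functions.
  -- Integrability of `f` suffices here, which matters because the lemma serves products of two `L²`
  -- functions.
  have hΛ : Λ' = 0 := by
    refine ContinuousLinearMap.ext_on (s := Set.range (fourier (T := 1))) ?_ ?_
    · rw [Submodule.dense_iff_topologicalClosure_eq_top]
      exact span_fourier_closure_eq_top
    · rintro _ ⟨n, rfl⟩
      have := h (-n)
      rw [fourierCoeff, neg_neg] at this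
      rw [hΛ']
      exact this
  -- Integrals over closed sets determine `f`, and the indicator of a closed set is a bounded
  -- pointwise limit of continuous functions.
  refine ae_eq_zero_of_forall_setIntegral_isClosed_eq_zero hf fun s hs => ?_
  have hpos : ∀ n : ℕ, 0 < 1 / ((n : ℝ) + 1) := fun n => Nat.one_div_pos_of_nat
  let φ : ℕ → C(Circ, ℂ) := fun n =>
    ⟨fun t => (((thickenedIndicator (hpos n) s t : ℝ≥0) : ℝ) : ℂ), by fun_prop⟩
  have h0 : ∀ n, ∫ t, φ n t * f t ∂circMeas = 0 := fun n => by
    rw [← hΛ', hΛ, zero_apply]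
  have hlim : Tendsto (fun n => ∫ t, φ n t * f t ∂circMeas) atTop
      (𝓝 (∫ t, s.indicator f t ∂circMeas)) := by
    refine tendsto_integral_of_dominated_convergence (fun t => ‖f t‖)
      (fun n => (hint (φ n)).1) hf.norm (fun n => ae_of_all _ fun t => ?_)
      (ae_of_all _ fun t => ?_)
    · have h1 : ‖φ n t‖ ≤ 1 := by
        have := thickenedIndicator_le_one (hpos n) s t
        simpa [φ] using this
      rw [norm_mul]
      exact mul_le_of_le_one_left (norm_nonneg _) h1
    · have h1 := thickenedIndicator_tendsto_indicator_closure hpos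
        tendsto_one_div_add_atTop_nhds_zero_nat s
      rw [hs.closure_eq] at h1
      have h2 := (tendsto_pi_nhds.mp h1) t
      have h3 : Tendsto (fun n => φ n t) atTop
          (𝓝 (((s.indicator (fun _ => (1 : ℝ≥0)) t : ℝ≥0) : ℝ) : ℂ)) :=
        (Complex.continuous_ofReal.comp NNReal.continuous_coe).continuousAt.tendsto.comp h2
      have h4 := h3.mul_const (f t)
      convert h4 using 2
      by_cases ht : t ∈ s <;> simp [ht]
  rw [integral_indicator hs.measurableSet] at hlim
  refine tendsto_nhds_unique hlim ?_
  simp only [h0]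
  exact tendsto_const_nhds

theorem ae_eq_of_fourierCoeff_eq {f g : Circ → ℂ} (hf : Integrable f circMeas)
    (hg : Integrable g circMeas) (h : ∀ n, fourierCoeff f n = fourierCoeff g n) :
    f =ᵐ[circMeas] g := by
  have hg' : Integrable (-g) circMeas := hg.neg
  have key := ae_eq_zero_of_fourierCoeff_eq_zero (hf.add hg') fun n => by
    rw [fourierCoeff.add hf hg', Pi.add_apply, h n]
    have := fourierCoeff_neg g n
    rw [show -g = fun t => -g t from rfl, this, add_neg_cancel]
  filter_upwards [key] with t ht
  simpa [add_neg_eq_zero] using ht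

/-- A function in `H¹(𝔻)` whose complex conjugate is in `H¹(𝔻)` is constant. -/
theorem ae_eq_const_of_fourierCoeff {f : Circ → ℂ} (hf : Integrable f circMeas)
    (h : ∀ n ≠ 0, fourierCoeff f n = 0) : ∀ᵐ t ∂circMeas, f t = fourierCoeff f 0 := by
  refine ae_eq_of_fourierCoeff_eq hf (integrable_const _) fun n => ?_
  rw [fourierCoeff_const]
  split_ifs with hn
  · rw [hn]
  · exact h n hn

/-! ### The norm of `L²(𝕋)` -/

theorem norm_sq_eq_integral (f : L2T) : ‖f‖ ^ 2 = ∫ t, ‖f t‖ ^ 2 ∂circMeas := by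
  rw [← tsum_sq_fourierCoeff]
  have h : ‖fourierBasis.repr f‖ ^ 2 = ‖f‖ ^ 2 := by simp
  rw [← h]
  simp_rw [← fourierBasis_repr]
  exact (HasSum.tsum_eq (by exact_mod_cast lp.hasSum_norm (by simp) (fourierBasis.repr f))).symm

theorem norm_sq_eq_tsum (f : L2T) : ‖f‖ ^ 2 = ∑' n : ℤ, ‖fourierCoeff f n‖ ^ 2 := by
  rw [norm_sq_eq_integral, tsum_sq_fourierCoeff]

theorem continuous_fourierCoeff (n : ℤ) : Continuous fun f : L2T => fourierCoeff f n := by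
  have : (fun f : L2T => fourierCoeff f n) = fun f : L2T => inner ℂ (fourierBasis n) f := by
    funext f
    rw [← fourierBasis_repr]
    exact fourierBasis.repr_apply_apply f n
  rw [this]
  fun_prop

theorem vanishBelow_of_tendsto {m : ℤ} {u : ℕ → L2T} {f : L2T}
    (hu : ∀ᶠ n in atTop, VanishBelow m (u n))
    (h : Tendsto u atTop (𝓝 f)) : VanishBelow m f := by
  refine ⟨Lp.memLp _, fun k hk => ?_⟩
  refine tendsto_nhds_unique (((continuous_fourierCoeff k).tendsto f).comp h) ?_
  refine tendsto_const_nhds.congr' ?_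
  filter_upwards [hu] with n hn
  exact (hn.2 k hk).symm

theorem norm_le_mul_of_ae {f g : L2T} {u v : Circ → ℂ} {C : ℝ} (hf : f =ᵐ[circMeas] u)
    (hg : g =ᵐ[circMeas] v) (h : ∀ᵐ t ∂circMeas, ‖u t‖ ≤ C * ‖v t‖) : ‖f‖ ≤ C * ‖g‖ := by
  refine Lp.norm_le_mul_norm_of_ae_le_mul ?_
  filter_upwards [hf, hg, h] with t h1 h2 h3
  rwa [h1, h2]

theorem exists_seq_tendsto_ae {u : ℕ → L2T} {f : L2T} (h : Tendsto u atTop (𝓝 f)) :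
    ∃ ns : ℕ → ℕ, StrictMono ns ∧
      ∀ᵐ t ∂circMeas, Tendsto (fun k => u (ns k) t) atTop (𝓝 (f t)) :=
  (tendstoInMeasure_of_tendsto_Lp h).exists_seq_tendsto_ae

/-! ### Absolutely convergent power series on the circle -/

theorem fourier_natCast (n : ℕ) (t : Circ) : fourier n t = (fourier 1 t) ^ n := by
  simp only [fourier_apply, one_zsmul, natCast_zsmul, toCircle_nsmul, Circle.coe_pow]

/-- The continuous function `∑ c n zⁿ` on the circle. -/
noncomputable def powerSeries (c : ℕ → ℂ) : C(Circ, ℂ) :=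
  ∑' n : ℕ, c n • fourier n

theorem hasSum_powerSeries {c : ℕ → ℂ} (hc : Summable c) :
    HasSum (fun n : ℕ => c n • (fourier n : C(Circ, ℂ))) (powerSeries c) := by
  refine Summable.hasSum (Summable.of_norm ?_)
  simp_rw [norm_smul, fourier_norm, mul_one]
  exact hc.norm

theorem powerSeries_apply {c : ℕ → ℂ} (hc : Summable c) (t : Circ) :
    powerSeries c t = ∑' n : ℕ, c n * (fourier 1 t) ^ n := by
  have h := (ContinuousMap.evalCLM ℂ t).hasSum (hasSum_powerSeries hc)
  refine h.tsum_eq.symm.trans ?_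
  refine tsum_congr fun n => ?_
  rw [← fourier_natCast]
  rfl

theorem fourierCoeff_powerSeries {c : ℕ → ℂ} (hc : Summable c) (k : ℤ) :
    fourierCoeff (powerSeries c) k = if 0 ≤ k then c k.toNat else 0 := by
  have h1 := (ContinuousMap.toLp (E := ℂ) 2 circMeas ℂ).hasSum (hasSum_powerSeries hc)
  have h2 := (innerSL ℂ (fourierLp (T := 1) 2 k)).hasSum h1
  have h3 : fourierCoeff (powerSeries c) k = innerSL ℂ (fourierLp (T := 1) 2 k)
      (ContinuousMap.toLp (E := ℂ) 2 circMeas ℂ (powerSeries c)) := by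
    rw [← fourierCoeff_toLp, ← fourierBasis_repr, HilbertBasis.repr_apply_apply, coe_fourierBasis]
    rfl
  rw [h3]
  refine h2.unique ?_
  have ho := orthonormal_iff_ite.mp (orthonormal_fourier (T := 1))
  have e : ∀ n : ℕ, innerSL ℂ (fourierLp (T := 1) 2 k)
      (ContinuousMap.toLp (E := ℂ) 2 circMeas ℂ (c n • fourier (n : ℤ))) =
      if k = n then c n else 0 := fun n => by
    rw [map_smul, map_smul, innerSL_apply_apply, ho]
    simp
  simp only [e]
  split_ifs with hk
  · convert hasSum_single k.toNat ?_ using 1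
    · rw [if_pos (by omega)]
    · intro n hn
      rw [if_neg (by omega)]
  · convert hasSum_zero with n
    rw [if_neg (by omega)]

theorem vanishBelow_powerSeries {c : ℕ → ℂ} (hc : Summable c) :
    VanishBelow 0 (powerSeries c) := by
  refine ⟨MemLp.of_bound (map_continuous _).aestronglyMeasurable ‖powerSeries c‖
    (ae_of_all _ fun t => (powerSeries c).norm_coe_le_norm t), fun n hn => ?_⟩
  rw [fourierCoeff_powerSeries hc, if_neg (by omega)]

/-! ### Analytic extension and inverses in the Hardy space -/

theorem exists_norm_fourierCoeff_le (f : Circ → ℂ) : ∃ C, ∀ n, ‖fourierCoeff f n‖ ≤ C := by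
  refine ⟨∫ t, ‖f t‖ ∂circMeas, fun n => (norm_integral_le_integral_norm _).trans_eq ?_⟩
  simp_rw [norm_smul, norm_fourier_apply, one_mul]

theorem differentiableOn_discVal (f : Circ → ℂ) :
    DifferentiableOn ℂ (discVal f) (Metric.ball 0 1) := by
  obtain ⟨C, hC⟩ := exists_norm_fourierCoeff_le f
  intro w hw
  rw [mem_ball_zero_iff] at hw
  obtain ⟨r, hr, hr1⟩ := exists_between hw
  have hr0 : 0 ≤ r := (norm_nonneg _).trans hr.le
  have h : DifferentiableOn ℂ (discVal f) (Metric.ball 0 r) := by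
    refine Complex.differentiableOn_tsum_of_summable_norm (u := fun n => C * r ^ n)
      ((summable_geometric_of_lt_one hr0 hr1).mul_left C) (fun n => by fun_prop)
      Metric.isOpen_ball fun n z hz => ?_
    rw [mem_ball_zero_iff] at hz
    rw [norm_mul, norm_pow]
    gcongr
    · exact (norm_nonneg _).trans (hC 0)
    · exact hC n
  exact (h.differentiableAt (Metric.isOpen_ball.mem_nhds (by simpa using hr))).differentiableWithinAt

theorem summable_fourierCoeff_mul_pow (f : Circ → ℂ) {r : ℝ} (h0 : 0 ≤ r) (h1 : r < 1) :
    Summable fun n : ℕ => fourierCoeff f n * (r : ℂ) ^ n := by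
  obtain ⟨C, hC⟩ := exists_norm_fourierCoeff_le f
  refine Summable.of_norm_bounded ((summable_geometric_of_lt_one h0 h1).mul_left C) fun n => ?_
  rw [norm_mul, norm_pow, Complex.norm_real, Real.norm_of_nonneg h0]
  gcongr
  exact hC n

/-- The dilation `z ↦ f (r z)` of `f`, on the circle. -/
noncomputable def dilation (f : Circ → ℂ) (r : ℝ) : C(Circ, ℂ) :=
  powerSeries fun n => fourierCoeff f n * (r : ℂ) ^ n

theorem dilation_apply (f : Circ → ℂ) {r : ℝ} (h0 : 0 ≤ r) (h1 : r < 1) (t : Circ) :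
    dilation f r t = discVal f (r * fourier 1 t) := by
  rw [dilation, powerSeries_apply (summable_fourierCoeff_mul_pow f h0 h1), discVal]
  simp_rw [mul_pow, mul_assoc]

/-- By Parseval the squared distance is `∑ |f̂(n)|² |rⁿ - 1|²`, and dominated convergence applies
since `|rⁿ - 1| ≤ 1`. -/
theorem tendsto_dilation {f : L2T} (hf : MemHardy f) {r : ℕ → ℝ} (h0 : ∀ k, 0 ≤ r k)
    (h1 : ∀ k, r k < 1) (hr : Tendsto r atTop (𝓝 1)) :
    Tendsto (fun k => ContinuousMap.toLp (E := ℂ) 2 circMeas ℂ (dilation f (r k))) atTop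
      (𝓝 f) := by
  rw [tendsto_iff_norm_sub_tendsto_zero]
  have key : Tendsto (fun k => ‖ContinuousMap.toLp (E := ℂ) 2 circMeas ℂ (dilation f (r k)) - f‖ ^ 2)
      atTop (𝓝 0) := by
    have e : ∀ k n, fourierCoeff
        (ContinuousMap.toLp (E := ℂ) 2 circMeas ℂ (dilation f (r k)) - f : L2T) n =
        fourierCoeff f n * ((r k : ℂ) ^ n.toNat - 1) := fun k n => by
      rw [fourierCoeff_congr_ae (Lp.coeFn_sub _ _)]
      refine (fourierCoeff_sub (Lp.memLp _) (Lp.memLp _) n).trans ?_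
      rw [fourierCoeff_toLp, dilation,
        fourierCoeff_powerSeries (summable_fourierCoeff_mul_pow f (h0 k) (h1 k))]
      split_ifs with hn
      · rw [Int.toNat_of_nonneg hn]; ring
      · rw [hf.2 n (by omega)]; ring
    simp_rw [norm_sq_eq_tsum, e]
    have hs : Summable fun n : ℤ => ‖fourierCoeff f n‖ ^ 2 := (hasSum_sq_fourierCoeff f).summable
    rw [show (0 : ℝ) = ∑' _ : ℤ, (0 : ℝ) from tsum_zero.symm]
    refine tendsto_tsum_of_dominated_convergence hs (fun n => ?_)
      (Eventually.of_forall fun k n => ?_)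
    · have hr' : Tendsto (fun k => (r k : ℂ)) atTop (𝓝 ((1 : ℝ) : ℂ)) :=
        (Complex.continuous_ofReal.tendsto 1).comp hr
      have := (((hr'.pow n.toNat).sub_const 1).const_mul (fourierCoeff f n)).norm.pow 2
      simpa using this
    · have hp : ‖(r k : ℂ) ^ n.toNat - 1‖ ≤ 1 := by
        rw [← Complex.ofReal_pow, ← Complex.ofReal_one, ← Complex.ofReal_sub, Complex.norm_real,
          Real.norm_eq_abs, abs_le]
        have := pow_le_one₀ (h0 k) (h1 k).le (n := n.toNat)
        have := pow_nonneg (h0 k) n.toNat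
        constructor <;> linarith
      rw [Real.norm_of_nonneg (by positivity), norm_mul]
      gcongr
      exact mul_le_of_le_one_right (norm_nonneg _) hp
  simpa using key.sqrt

/-- The reciprocal of the extension is analytic in the disc, so its dilations are power series
converging absolutely on the circle. They tend to `1/f` in `L²` because inversion is Lipschitz with
constant `δ⁻²` away from the disc of radius `δ`, and closedness of `H²(𝔻)` finishes. -/
theorem inv_memHardy {f : Circ → ℂ} (hf : MemHardy f) {δ : ℝ} (hδ : 0 < δ)
    (h : ∀ w : ℂ, ‖w‖ < 1 → δ ≤ ‖discVal f w‖) :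
    (∀ᵐ t ∂circMeas, δ ≤ ‖f t‖) ∧ MemHardy (fun t => (f t)⁻¹) := by
  obtain ⟨F, hF⟩ : ∃ F : L2T, F =ᵐ[circMeas] f := ⟨hf.1.toLp f, hf.1.coeFn_toLp⟩
  have hdisc : discVal F = discVal f := by
    funext w
    simp only [discVal, fourierCoeff_congr_ae hF]
  have hFh : MemHardy F := VanishBelow.congr hf hF.symm
  obtain ⟨r, hr1, hr01, hr⟩ := exists_seq_strictMono_tendsto' (show (0 : ℝ) < 1 by norm_num)
  have h0 : ∀ k, 0 ≤ r k := fun k => (hr01 k).1.le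
  have h1 : ∀ k, r k < 1 := fun k => (hr01 k).2
  have hlim := tendsto_dilation hFh h0 h1 hr
  have hnorm : ∀ k (t : Circ), ‖(r k : ℂ) * fourier 1 t‖ < 1 := fun k t => by
    rw [norm_mul, norm_fourier_apply, mul_one, Complex.norm_real, Real.norm_of_nonneg (h0 k)]
    exact h1 k
  have hlow : ∀ k t, δ ≤ ‖dilation F (r k) t‖ := fun k t => by
    rw [dilation_apply _ (h0 k) (h1 k), hdisc]
    exact h _ (hnorm k t)
  have hne : ∀ k t, dilation F (r k) t ≠ 0 := fun k t =>
    norm_pos_iff.mp (hδ.trans_le (hlow k t))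
  have hae : ∀ᵐ t ∂circMeas, δ ≤ ‖F t‖ := by
    obtain ⟨ns, -, hns⟩ := exists_seq_tendsto_ae hlim
    filter_upwards [hns, ae_all_iff.mpr fun k =>
      ContinuousMap.coeFn_toLp (p := 2) (𝕜 := ℂ) circMeas (dilation F (r k))] with t ht hd
    refine ge_of_tendsto' ht.norm fun k => ?_
    rw [hd]
    exact hlow _ _
  have haef : ∀ᵐ t ∂circMeas, δ ≤ ‖f t‖ := by
    filter_upwards [hae, hF] with t ht h2
    rwa [← h2]
  refine ⟨haef, ?_⟩
  let β : ℕ → C(Circ, ℂ) := fun k => ⟨fun t => (dilation F (r k) t)⁻¹,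
    (map_continuous _).inv₀ (hne k)⟩
  have hmem : MemLp (fun t => (F t)⁻¹) 2 circMeas := by
    refine MemLp.of_bound (Lp.aestronglyMeasurable F).inv₀ δ⁻¹ ?_
    filter_upwards [hae] with t ht
    rw [norm_inv]
    gcongr
  have hβ : ∀ k, MemHardy (β k) := fun k => by
    have hd : DifferentiableOn ℂ (fun w => (discVal F w)⁻¹) (Metric.ball 0 1) :=
      (differentiableOn_discVal F).inv fun w hw => by
        rw [hdisc]
        exact norm_pos_iff.mp (hδ.trans_le (h w (by simpa using hw)))
    have hsum := Complex.hasSum_taylorSeries_on_ball hd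
    let c : ℕ → ℂ := fun n => (n.factorial : ℂ)⁻¹ *
      iteratedDeriv n (fun w => (discVal F w)⁻¹) 0 * (r k : ℂ) ^ n
    have hc : Summable c := by
      have := (hsum (z := (r k : ℂ)) (by simpa [abs_of_nonneg (h0 k)] using h1 k)).summable
      refine this.congr fun n => ?_
      simp only [sub_zero, smul_eq_mul, c]
      ring
    have hβc : β k = powerSeries c := by
      ext t
      rw [powerSeries_apply hc]
      have := (hsum (z := (r k : ℂ) * fourier 1 t) (by simpa using hnorm k t)).tsum_eq
      change (dilation F (r k) t)⁻¹ = _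
      rw [dilation_apply _ (h0 k) (h1 k), ← this]
      refine tsum_congr fun n => ?_
      simp only [sub_zero, smul_eq_mul, c, mul_pow]
      ring
    rw [hβc]
    exact vanishBelow_powerSeries hc
  have hβlim : Tendsto (fun k => ContinuousMap.toLp (E := ℂ) 2 circMeas ℂ (β k)) atTop
      (𝓝 (hmem.toLp _)) := by
    rw [tendsto_iff_norm_sub_tendsto_zero] at hlim ⊢
    refine squeeze_zero (fun _ => norm_nonneg _) (fun k => ?_)
      (by simpa using hlim.const_mul (δ⁻¹ * δ⁻¹))
    refine norm_le_mul_of_ae (Lp.coeFn_sub _ _) (Lp.coeFn_sub _ _) ?_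
    filter_upwards [ContinuousMap.coeFn_toLp (p := 2) (𝕜 := ℂ) circMeas (dilation F (r k)),
      ContinuousMap.coeFn_toLp (p := 2) (𝕜 := ℂ) circMeas (β k), hmem.coeFn_toLp, hae]
      with t e1 e2 e3 e4
    simp only [Pi.sub_apply, e1, e2, e3]
    change ‖(dilation F (r k) t)⁻¹ - (F t)⁻¹‖ ≤ _
    rw [inv_sub_inv (hne k t) (norm_pos_iff.mp (hδ.trans_le e4)), norm_div, norm_mul,
      norm_sub_rev, div_eq_mul_inv, mul_comm, mul_inv]
    have := hlow k t
    gcongr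
  have := vanishBelow_of_tendsto (Eventually.of_forall fun k => VanishBelow.congr (hβ k)
    (ContinuousMap.coeFn_toLp (p := 2) (𝕜 := ℂ) circMeas (β k)).symm) hβlim
  refine this.congr ?_
  filter_upwards [hmem.coeFn_toLp, hF] with t e1 e2
  rw [e1, e2]

/-! ### Values at infinity and unpacking the spaces of pairs -/

theorem discVal_zero (f : Circ → ℂ) : discVal f 0 = fourierCoeff f 0 := by
  rw [discVal, tsum_eq_single 0 fun n hn => by rw [zero_pow hn, mul_zero]]
  simp

theorem valInfty_eq (f : Circ → ℂ) : valInfty f = fourierCoeff f 0 := by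
  change conj (discVal (star f) 0) = _
  rw [discVal_zero, fourierCoeff_zero_star, RCLike.conj_conj]

theorem posAtInfty_iff {f : Circ → ℂ} :
    PosAtInfty f ↔ (fourierCoeff f 0).im = 0 ∧ 0 < (fourierCoeff f 0).re := by
  rw [PosAtInfty, valInfty_eq]

theorem mul_star_add_mul_star_eq_one_iff {x y : ℂ} :
    x * star x + y * star y = 1 ↔ ‖x‖ ^ 2 + ‖y‖ ^ 2 = 1 := by
  rw [Complex.star_def, Complex.mul_conj', Complex.mul_conj']
  norm_cast

theorem norm_le_one_of_unit {x y : ℂ} (h : x * star x + y * star y = 1) : ‖x‖ ≤ 1 ∧ ‖y‖ ≤ 1 := by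
  rw [mul_star_add_mul_star_eq_one_iff] at h
  constructor <;> nlinarith [norm_nonneg x, norm_nonneg y, sq_nonneg ‖x‖, sq_nonneg ‖y‖]

theorem memLp_of_star {f : Circ → ℂ} (hf : MemLp (fun t => star (f t)) 2 circMeas) :
    MemLp f 2 circMeas := by
  have e : star (fun t => star (f t)) = f := star_star f
  exact e ▸ hf.star

theorem VanishBelow.star_of_forall {m : ℤ} {f : Circ → ℂ} (hf : MemLp f 2 circMeas)
    (h : ∀ n, -m < n → fourierCoeff f n = 0) : VanishBelow m (fun t => star (f t)) :=
  ⟨hf.star, fun n hn => by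
    have := fourierCoeff_star f n
    rw [show (fun t => star (f t)) = star f from rfl, this, h _ (by omega), map_zero]⟩

theorem VanishBelow.fourierCoeff_eq_zero_of_star {m : ℤ} {f : Circ → ℂ}
    (h : VanishBelow m (fun t => star (f t))) {n : ℤ} (hn : -m < n) : fourierCoeff f n = 0 := by
  have h1 := h.2 (-n) (by omega)
  rw [show (fun t => star (f t)) = star f from rfl, fourierCoeff_star, neg_neg] at h1
  simpa using h1

/-- If `u` and `v` generate an invertible element over bounded elements of the Hardy space, they
have no common inner factor. -/
theorem noCommonInnerFactor_of_bezout {α p q u v : Circ → ℂ} {M : ℝ}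
    (h : ∀ᵐ t ∂circMeas, α t = p t * u t - q t * v t)
    (hp : MemHardy p) (hp1 : ∀ᵐ t ∂circMeas, ‖p t‖ ≤ 1)
    (hq : MemHardy q) (hq1 : ∀ᵐ t ∂circMeas, ‖q t‖ ≤ 1)
    (hα : MemHardy fun t => (α t)⁻¹) (hα1 : ∀ᵐ t ∂circMeas, ‖(α t)⁻¹‖ ≤ M)
    (hα0 : ∀ᵐ t ∂circMeas, α t ≠ 0) :
    NoCommonInnerFactor u v := by
  rintro g ⟨hg, hg1⟩ hu hv
  have h1 : VanishBelow (0 + 0) _ := VanishBelow.mul hp hu (memLp_bdd_mul hp.1.1 hp1 hu.1)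
  have h2 : VanishBelow (0 + 0) _ := VanishBelow.mul hq hv (memLp_bdd_mul hq.1.1 hq1 hv.1)
  have h3 : VanishBelow (0 + (0 + 0)) _ :=
    VanishBelow.mul hα (h1.sub h2) (memLp_bdd_mul hα.1.1 hα1 (h1.sub h2).1)
  -- Since `g` is unimodular, `g^* = g⁻¹ = α⁻¹ (p (u g⁻¹) - q (v g⁻¹))`, which is in `H²(𝔻)`. So `g`
  -- and `g^*` are both analytic.
  have h4 : VanishBelow 0 (fun t => star (g t)) := by
    refine (h3.mono (k := 0) (by omega)).congr ?_
    filter_upwards [h, hg1, hα0] with t e1 e2 e3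
    have e4 : star (g t) = (g t)⁻¹ := by
      rw [Complex.inv_def, Complex.normSq_eq_norm_sq, e2]
      simp
    calc _ = (α t)⁻¹ * (p t * u t - q t * v t) * (g t)⁻¹ := by ring
      _ = _ := by rw [← e1, inv_mul_cancel₀ e3, one_mul, e4]
  refine ⟨fourierCoeff g 0, ae_eq_const_of_fourierCoeff (hg.1.integrable one_le_two)
    fun n hn => ?_⟩
  rcases hn.lt_or_gt with hn | hn
  · exact hg.2 n hn
  · exact h4.fourierCoeff_eq_zero_of_star (by omega)

/-! ### Pairs in the space `𝐁` -/

/-- The properties of pairs in `𝐁` that the factorization depends on. -/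
structure IsBPair (a b : Circ → ℂ) (s : ℝ) : Prop where
  memLp_b : MemLp b 2 circMeas
  unit : ∀ᵐ t ∂circMeas, a t * star (a t) + b t * star (b t) = 1
  star_a : VanishBelow 0 (fun t => star (a t))
  inv_star_a : VanishBelow 0 (fun t => (star (a t))⁻¹)
  ne_zero : ∀ᵐ t ∂circMeas, a t ≠ 0
  inv_le : ∀ᵐ t ∂circMeas, ‖(star (a t))⁻¹‖ ≤ 2
  ratio_le : ∀ᵐ t ∂circMeas, ‖b t / a t‖ ≤ s
  nonneg : 0 ≤ s
  lt_one : s < 1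
  im_eq : (fourierCoeff a 0).im = 0
  re_pos : 0 < (fourierCoeff a 0).re

theorem exists_isBPair {a b : L2T} (h : (a, b) ∈ spaceB) : ∃ s, IsBPair a b s := by
  obtain ⟨⟨hunit, hstar, hpos⟩, hinf⟩ := h
  rw [posAtInfty_iff] at hpos
  set c := sInf ((fun z => ‖discStarVal a z‖ ^ 2) '' discStar) with hc
  have hle : ∀ z ∈ discStar, c ≤ ‖discStarVal a z‖ ^ 2 := fun z hz =>
    csInf_le ⟨0, by rintro _ ⟨z, -, rfl⟩; positivity⟩ ⟨z, hz, rfl⟩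
  have hdisc : ∀ w : ℂ, ‖w‖ < 1 → √c ≤ ‖discVal (star ⇑a) w‖ := fun w hw => by
    rw [← Real.sqrt_sq (norm_nonneg _)]
    apply Real.sqrt_le_sqrt
    by_cases h0 : w = 0
    · have := hle OnePoint.infty (Or.inl rfl)
      change c ≤ ‖conj (discVal (star ⇑a) 0)‖ ^ 2 at this
      rwa [h0, ← RCLike.norm_conj]
    · have h1 : (((conj w)⁻¹ : ℂ) : OnePoint ℂ) ∈ discStar := by
        refine Or.inr ⟨(conj w)⁻¹, ?_, rfl⟩
        simp only [Set.mem_ofPred_eq, norm_inv, RCLike.norm_conj]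
        exact (one_lt_inv₀ (norm_pos_iff.mpr h0)).mpr hw
      have := hle _ h1
      change c ≤ ‖conj (discVal (star ⇑a) (conj (conj w)⁻¹)⁻¹)‖ ^ 2 at this
      rwa [RCLike.norm_conj, map_inv₀, RCLike.conj_conj, inv_inv] at this
  have hc0 : 0 < c := by linarith
  obtain ⟨h1, h2⟩ := inv_memHardy hstar (Real.sqrt_pos.mpr hc0) hdisc
  have h1' : ∀ᵐ t ∂circMeas, c ≤ ‖a t‖ ^ 2 := by
    filter_upwards [h1] with t ht
    rw [Pi.star_apply, norm_star] at ht
    exact (Real.sqrt_le_left (norm_nonneg _)).mp ht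
  -- On the circle `|a|² ≥ c` and `|b|² = 1 - |a|² ≤ 1 - c`. The resulting bound for `|b/a|` is
  -- below `1` exactly because `c > 1/2`; the same inequality gives `|a| ≥ 1/2`.
  refine ⟨√((1 - c) / c), Lp.memLp b, hunit, hstar, h2, ?_, ?_, ?_, Real.sqrt_nonneg _, ?_,
    hpos.1, hpos.2⟩
  · filter_upwards [h1'] with t ht h0
    rw [h0, norm_zero] at ht
    linarith
  · filter_upwards [h1'] with t ht
    rw [norm_inv, norm_star]
    refine inv_le_of_inv_le₀ (by norm_num) ?_
    by_contra! hlt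
    nlinarith [norm_nonneg (a t)]
  · filter_upwards [h1', hunit] with t ht hu
    rw [mul_star_add_mul_star_eq_one_iff] at hu
    apply Real.le_sqrt_of_sq_le
    rw [norm_div, div_pow, div_le_div_iff₀ (by linarith) hc0]
    nlinarith
  · rw [Real.sqrt_lt' one_pos, one_pow, div_lt_one hc0]
    linarith

namespace IsBPair

variable {a b : Circ → ℂ} {s : ℝ} (h : IsBPair a b s)
include h

theorem memLp_a : MemLp a 2 circMeas := memLp_of_star h.star_a.1

theorem aestronglyMeasurable_ratio : AEStronglyMeasurable (fun t => b t / a t) circMeas := by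
  simp only [div_eq_mul_inv]
  exact h.memLp_b.1.mul h.memLp_a.1.inv₀

theorem memLp_ratio_mul {f : Circ → ℂ} (hf : MemLp f 2 circMeas) :
    MemLp (fun t => b t / a t * f t) 2 circMeas :=
  memLp_bdd_mul h.aestronglyMeasurable_ratio h.ratio_le hf

end IsBPair

/-! ### Factorization and the fixed point equations -/

/-- The fixed point equations in terms of Fourier supports. -/
structure FixedEqs (a b A B : Circ → ℂ) : Prop where
  star_A : VanishBelow 0 (fun t => star (A t))
  mem_B : VanishBelow 0 B
  fst : VanishBelow 0 (fun t => star (star (A t) + b t / a t * star (B t)))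
  fst_zero : fourierCoeff (fun t => star (star (A t) + b t / a t * star (B t))) 0 = 1
  snd : VanishBelow 1 (fun t => star (B t - b t / a t * A t))

/-- `(am, bm)(ap, bp) = (a, b)` with `(ap, bp)` in `𝐇` and `(am, bm)` in `𝐇₀^*`, up to the
conditions on inner factors. -/
structure IsFactorization (a b am bm ap bp : Circ → ℂ) : Prop where
  unit_p : ∀ᵐ t ∂circMeas, ap t * star (ap t) + bp t * star (bp t) = 1
  unit_m : ∀ᵐ t ∂circMeas, am t * star (am t) + bm t * star (bm t) = 1
  star_ap : VanishBelow 0 (fun t => star (ap t))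
  mem_bp : VanishBelow 0 bp
  star_am : VanishBelow 0 (fun t => star (am t))
  star_bm : VanishBelow 1 (fun t => star (bm t))
  im_ap : (fourierCoeff ap 0).im = 0
  re_ap : 0 < (fourierCoeff ap 0).re
  im_am : (fourierCoeff am 0).im = 0
  re_am : 0 < (fourierCoeff am 0).re
  fst : ∀ᵐ t ∂circMeas, am t * ap t - bm t * star (bp t) = a t
  snd : ∀ᵐ t ∂circMeas, am t * bp t + bm t * star (ap t) = b t

theorem fourierCoeff_add_of_integrable {f g : Circ → ℂ} (hf : Integrable f circMeas)
    (hg : Integrable g circMeas) (n : ℤ) :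
    fourierCoeff (fun t => f t + g t) n = fourierCoeff f n + fourierCoeff g n :=
  congrFun (fourierCoeff.add hf hg) n

namespace FixedEqs

variable {a b A B : Circ → ℂ}

/-- The function equals `A^* (A^* + (b/a) B^*)^* + B (B - (b/a) A)^*`, since the mixed terms cancel.
Each product has both factors analytic, so there are no negative frequencies, and realness excludes
the positive ones. The second product vanishes at `0`, leaving `A^*(0) · 1` as the mean. -/
theorem norm_sq_add (h : FixedEqs a b A B) :
    ∀ᵐ t ∂circMeas, A t * star (A t) + B t * star (B t) = fourierCoeff A 0 := by
  have hA : MemLp A 2 circMeas := memLp_of_star h.star_A.1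
  have i1 : Integrable (fun t => star (A t) * star (star (A t) + b t / a t * star (B t)))
    circMeas := h.star_A.1.integrable_mul h.fst.1
  have i2 : Integrable (fun t => B t * star (B t - b t / a t * A t)) circMeas :=
    h.mem_B.1.integrable_mul h.snd.1
  have e : (fun t => A t * star (A t) + B t * star (B t)) = fun t =>
      star (A t) * star (star (A t) + b t / a t * star (B t)) +
        B t * star (B t - b t / a t * A t) := by
    funext t
    simp only [star_add, star_sub, star_mul', star_star]
    ring
  have hlow : ∀ n : ℤ, n < 0 →
      fourierCoeff (fun t => A t * star (A t) + B t * star (B t)) n = 0 := fun n hn => by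
    rw [e, fourierCoeff_add_of_integrable i1 i2, h.star_A.fourierCoeff_mul_of_lt h.fst (by omega),
      h.mem_B.fourierCoeff_mul_of_lt h.snd (by omega), add_zero]
  have hzero : fourierCoeff (fun t => A t * star (A t) + B t * star (B t)) 0 =
      conj (fourierCoeff A 0) := by
    rw [e, fourierCoeff_add_of_integrable i1 i2, h.mem_B.fourierCoeff_mul_of_lt h.snd (by omega),
      add_zero]
    have := h.star_A.fourierCoeff_mul h.fst
    rw [add_zero] at this
    rw [this, h.fst_zero, mul_one]
    exact fourierCoeff_zero_star A
  have hstar : star (fun t => A t * star (A t) + B t * star (B t)) =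
      fun t => A t * star (A t) + B t * star (B t) := by
    funext t
    simp only [Pi.star_apply, star_add, star_mul', star_star]
    ring
  have hint : Integrable (fun t => A t * star (A t) + B t * star (B t)) circMeas := by
    rw [e]
    exact i1.add i2
  have key := ae_eq_const_of_fourierCoeff hint fun n hn => by
    rcases hn.lt_or_gt with hn | hn
    · exact hlow n hn
    · rw [← hstar, fourierCoeff_star, hlow _ (by omega), map_zero]
  have h0 : fourierCoeff (fun t => A t * star (A t) + B t * star (B t)) 0 = fourierCoeff A 0 := by
    conv_lhs => rw [← hstar]
    rw [fourierCoeff_zero_star, hzero, RCLike.conj_conj]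
  rw [h0] at key
  exact key

/-- `A(∞)` is the constant `|A|² + |B|²`. Were it zero, `A` and `B` would vanish, against the
normalization `fst_zero`. -/
theorem posAtInfty (h : FixedEqs a b A B) :
    (fourierCoeff A 0).im = 0 ∧ 0 < (fourierCoeff A 0).re := by
  have key := h.norm_sq_add
  obtain ⟨t, ht⟩ := key.exists
  have hC : fourierCoeff A 0 = ((‖A t‖ ^ 2 + ‖B t‖ ^ 2 : ℝ) : ℂ) := by
    rw [← ht, Complex.star_def, Complex.mul_conj', Complex.mul_conj']
    norm_cast
  have hre : 0 ≤ (fourierCoeff A 0).re := by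
    rw [hC, Complex.ofReal_re]
    positivity
  refine ⟨by rw [hC, Complex.ofReal_im], hre.lt_of_ne fun h0 => ?_⟩
  have h00 : fourierCoeff A 0 = 0 := by
    rw [hC, Complex.ofReal_re] at h0
    rw [hC, ← h0, Complex.ofReal_zero]
  have hzero : (fun t => star (star (A t) + b t / a t * star (B t))) =ᵐ[circMeas]
      fun _ => (0 : ℂ) := by
    filter_upwards [key] with t ht
    rw [h00, Complex.star_def, Complex.mul_conj', Complex.mul_conj'] at ht
    norm_cast at ht
    have hA : A t = 0 := norm_eq_zero.mp (by nlinarith [sq_nonneg ‖A t‖, sq_nonneg ‖B t‖])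
    have hB : B t = 0 := norm_eq_zero.mp (by nlinarith [sq_nonneg ‖A t‖, sq_nonneg ‖B t‖])
    simp [hA, hB]
  have := h.fst_zero
  rw [fourierCoeff_congr_ae hzero, fourierCoeff_const] at this
  simp at this

end FixedEqs

/-- The left factor is forced to be `(a, b)` times the inverse of the right one. Its conjugated
entries are `a^*` times the functions in `FixedEqs`, up to the constants `c` and `-c`, so the
support conditions follow from `a^* ∈ H²(𝔻)`. The choice of `c` makes `c² (|A|² + |B|²) = 1`. -/
theorem FixedEqs.isFactorization {a b A B : Circ → ℂ} {s : ℝ} (hab : IsBPair a b s)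
    (h : FixedEqs a b A B) :
    let c : ℂ := (((Real.sqrt (fourierCoeff A 0).re)⁻¹ : ℝ) : ℂ)
    IsFactorization a b (fun t => a t * star (c * A t) + b t * star (c * B t))
      (fun t => b t * (c * A t) - a t * (c * B t)) (fun t => c * A t) (fun t => c * B t) := by
  intro c
  obtain ⟨him, hre⟩ := h.posAtInfty
  set C := (fourierCoeff A 0).re with hC
  have hCe : fourierCoeff A 0 = (C : ℂ) := Complex.ext (by simp [hC]) (by simp [him])
  have hcs : star c = c := Complex.conj_ofReal _
  have hcc : c * c * C = 1 := by
    rw [← Complex.ofReal_mul, ← Complex.ofReal_mul, ← mul_inv, Real.mul_self_sqrt hre.le,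
      inv_mul_cancel₀ hre.ne', Complex.ofReal_one]
  have hsq : 0 < (√C)⁻¹ := inv_pos.mpr (Real.sqrt_pos.mpr hre)
  have hunit : ∀ᵐ t ∂circMeas, c * A t * star (c * A t) + c * B t * star (c * B t) = 1 := by
    filter_upwards [h.norm_sq_add] with t ht
    rw [star_mul', star_mul', hcs, ← hcc, ← hCe, ← ht]
    ring
  have ham : ∀ᵐ t ∂circMeas, c * (star (a t) * star (star (A t) + b t / a t * star (B t))) =
      star (a t * star (c * A t) + b t * star (c * B t)) := by
    filter_upwards [hab.ne_zero] with t ht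
    rw [← star_mul']
    simp only [star_mul', hcs, star_add, star_star, star_div₀]
    have : star (a t) ≠ 0 := star_ne_zero.mpr ht
    field_simp
  have hbm : ∀ᵐ t ∂circMeas, -c * (star (a t) * star (B t - b t / a t * A t)) =
      star (b t * (c * A t) - a t * (c * B t)) := by
    filter_upwards [hab.ne_zero] with t ht
    simp only [star_mul', hcs, star_sub, star_div₀]
    have : star (a t) ≠ 0 := star_ne_zero.mpr ht
    field_simp
    ring
  have hstar1 : ∀ᵐ t ∂circMeas, ‖star (a t)‖ ≤ 1 := by
    filter_upwards [hab.unit] with t ht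
    rw [norm_star]
    exact (norm_le_one_of_unit ht).1
  have m1 := hab.star_a.mul h.fst (memLp_bdd_mul hab.star_a.1.1 hstar1 h.fst.1)
  have m2 := hab.star_a.mul h.snd (memLp_bdd_mul hab.star_a.1.1 hstar1 h.snd.1)
  -- Evaluation at `0` is multiplicative for analytic factors and the bracket in `ham` has value `1`
  -- there, so `a_-(∞) = c a(∞)`.
  have hval : fourierCoeff (fun t => a t * star (c * A t) + b t * star (c * B t)) 0 =
      c * fourierCoeff a 0 := by
    have e1 := hab.star_a.fourierCoeff_mul h.fst
    rw [h.fst_zero, mul_one, add_zero] at e1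
    have e2 := congrFun (fourierCoeff_congr_ae ham) 0
    rw [fourierCoeff.const_mul, e1] at e2
    have e3 := fourierCoeff_zero_star (fun t => a t * star (c * A t) + b t * star (c * B t))
    have e4 := fourierCoeff_zero_star a
    change fourierCoeff (fun t => star (a t)) 0 = _ at e4
    rw [e4] at e2
    have e5 := congrArg conj (e2.trans e3)
    rw [map_mul, RCLike.conj_conj, RCLike.conj_conj, ← Complex.star_def, hcs] at e5
    exact e5.symm
  refine ⟨hunit, ?_, ?_, h.mem_B.const_mul c, ?_, ?_, ?_, ?_, ?_, ?_, ?_, ?_⟩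
  · filter_upwards [hunit, hab.unit] with t e1 e2
    simp only [star_add, star_sub, star_mul', star_star] at e1 ⊢
    linear_combination e1 * (a t * star (a t) + b t * star (b t)) + e2
  · refine (h.star_A.const_mul c).congr (ae_of_all _ fun t => ?_)
    simp only [star_mul', hcs]
  · exact (m1.const_mul c).congr ham
  · exact (m2.const_mul (-c)).congr hbm
  · rw [fourierCoeff.const_mul, hCe, ← Complex.ofReal_mul, Complex.ofReal_im]
  · rw [fourierCoeff.const_mul, hCe, ← Complex.ofReal_mul, Complex.ofReal_re]
    positivity
  · rw [hval, Complex.im_ofReal_mul, hab.im_eq, mul_zero]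
  · rw [hval, Complex.re_ofReal_mul]
    exact mul_pos hsq hab.re_pos
  · filter_upwards [hunit] with t e1
    linear_combination a t * e1
  · filter_upwards [hunit] with t e1
    linear_combination b t * e1

namespace IsFactorization

variable {a b am bm ap bp : Circ → ℂ} {s : ℝ}

theorem eq_mul (h : IsFactorization a b am bm ap bp) : ∀ᵐ t ∂circMeas,
    a t * star (ap t) + b t * star (bp t) = am t ∧ b t * ap t - a t * bp t = bm t := by
  filter_upwards [h.unit_p, h.fst, h.snd] with t e1 e2 e3
  rw [← e2, ← e3]
  constructor
  · linear_combination am t * e1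
  · linear_combination bm t * e1

/-- Dividing `a_-` and `b_-` by `a` keeps the supports because `1/a^*` is analytic. The scaling `γ =
a_+(∞)` is what turns the value at `∞` of the first function into `1`. -/
theorem fixedEqs (hab : IsBPair a b s) (h : IsFactorization a b am bm ap bp) :
    FixedEqs a b (fun t => fourierCoeff ap 0 * ap t) (fun t => fourierCoeff ap 0 * bp t) := by
  set γ := fourierCoeff ap 0 with hγ
  have hγs : star γ = γ := Complex.conj_eq_iff_im.mpr h.im_ap
  have e1 : ∀ᵐ t ∂circMeas, γ * ((star (a t))⁻¹ * star (am t)) =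
      star (star (γ * ap t) + b t / a t * star (γ * bp t)) := by
    filter_upwards [hab.ne_zero, h.eq_mul] with t h0 e
    rw [← e.1]
    simp only [star_mul', hγs, star_add, star_star, star_div₀]
    have : star (a t) ≠ 0 := star_ne_zero.mpr h0
    field_simp
  have e2 : ∀ᵐ t ∂circMeas, -γ * ((star (a t))⁻¹ * star (bm t)) =
      star (γ * bp t - b t / a t * (γ * ap t)) := by
    filter_upwards [hab.ne_zero, h.eq_mul] with t h0 e
    rw [← e.2]
    simp only [star_mul', hγs, star_sub, star_div₀]
    have : star (a t) ≠ 0 := star_ne_zero.mpr h0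
    field_simp
    ring
  have m1 := hab.inv_star_a.mul h.star_am
    (memLp_bdd_mul hab.inv_star_a.1.1 hab.inv_le h.star_am.1)
  have m2 := hab.inv_star_a.mul h.star_bm
    (memLp_bdd_mul hab.inv_star_a.1.1 hab.inv_le h.star_bm.1)
  refine ⟨?_, h.mem_bp.const_mul γ, (m1.const_mul γ).congr e1, ?_, (m2.const_mul (-γ)).congr e2⟩
  · refine (h.star_ap.const_mul γ).congr (ae_of_all _ fun t => ?_)
    simp only [star_mul', hγs]
  · rw [← fourierCoeff_congr_ae e1, fourierCoeff.const_mul]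
    have f1 := hab.inv_star_a.fourierCoeff_mul h.star_am
    have f2 := hab.inv_star_a.fourierCoeff_mul hab.star_a
    rw [add_zero] at f1 f2
    have f3 : fourierCoeff (fun t => (star (a t))⁻¹ * star (a t)) 0 = 1 := by
      have : (fun t => (star (a t))⁻¹ * star (a t)) =ᵐ[circMeas] fun _ => (1 : ℂ) := by
        filter_upwards [hab.ne_zero] with t ht
        exact inv_mul_cancel₀ (star_ne_zero.mpr ht)
      rw [fourierCoeff_congr_ae this, fourierCoeff_const, if_pos rfl]
    -- This is `a(∞) = a_-(∞) a_+(∞)`: the other term `b_-^* b_+` of `a^*` vanishes at `0`.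
    have f4 : fourierCoeff (fun t => star (a t)) 0 =
        fourierCoeff (fun t => star (am t)) 0 * γ := by
      have i1 : Integrable (fun t => star (am t) * star (ap t)) circMeas :=
        h.star_am.1.integrable_mul h.star_ap.1
      have i2 : Integrable (fun t => -(star (bm t) * bp t)) circMeas :=
        (h.star_bm.1.integrable_mul h.mem_bp.1).neg
      have : (fun t => star (a t)) =ᵐ[circMeas]
          fun t => star (am t) * star (ap t) + -(star (bm t) * bp t) := by
        filter_upwards [h.fst] with t ht
        rw [← ht]
        simp only [star_mul', star_sub, star_star]
        ring
      have f5 := h.star_am.fourierCoeff_mul h.star_ap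
      rw [add_zero] at f5
      have f6 := fourierCoeff_zero_star ap
      change fourierCoeff (fun t => star (ap t)) 0 = star γ at f6
      rw [fourierCoeff_congr_ae this, fourierCoeff_add_of_integrable i1 i2, fourierCoeff_neg,
        h.star_bm.fourierCoeff_mul_of_lt h.mem_bp (by omega), neg_zero, add_zero, f5, f6, hγs]
    rw [f1, ← f3, f2, f4]
    ring

end IsFactorization

/-! ### The Cauchy projection and the fixed point map -/

theorem ext_fourierCoeff {f g : L2T} (h : ∀ n, fourierCoeff f n = fourierCoeff g n) : f = g :=
  Lp.ext (ae_eq_of_fourierCoeff_eq ((Lp.memLp f).integrable one_le_two)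
    ((Lp.memLp g).integrable one_le_two) h)

theorem cauchyProj_memHardy (f : L2T) : MemHardy (cauchyProj f) :=
  hardySubmodule.starProjection_apply_mem f

theorem fourierCoeff_cauchyProj (f : L2T) {n : ℤ} (hn : 0 ≤ n) :
    fourierCoeff (cauchyProj f) n = fourierCoeff f n := by
  have hmem : fourierLp 2 n ∈ hardySubmodule := by
    refine (VanishBelow.congr ((VanishBelow.const 1).fourier_mul n |>.mono (k := 0) (by omega))
      ?_ : VanishBelow 0 _)
    filter_upwards [coeFn_fourierLp (T := 1) 2 n] with t ht
    rw [ht, mul_one]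
  have h := Submodule.sub_starProjection_mem_orthogonal (K := hardySubmodule) f
  have h2 := (Submodule.mem_orthogonal _ _).mp h _ hmem
  rw [inner_sub_right, sub_eq_zero] at h2
  have e : ∀ g : L2T, inner ℂ (fourierLp (T := 1) 2 n) g = fourierCoeff g n := fun g => by
    rw [← fourierBasis_repr, HilbertBasis.repr_apply_apply, coe_fourierBasis]
  rw [e, e] at h2
  exact h2.symm

theorem cauchyProj_eq_iff {f g : L2T} :
    cauchyProj f = g ↔ MemHardy g ∧ ∀ n, 0 ≤ n → fourierCoeff g n = fourierCoeff f n := by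
  constructor
  · rintro rfl
    exact ⟨cauchyProj_memHardy f, fun n hn => fourierCoeff_cauchyProj f hn⟩
  · rintro ⟨hg, h⟩
    refine ext_fourierCoeff fun n => ?_
    rcases lt_or_ge n 0 with hn | hn
    · rw [(cauchyProj_memHardy f).2 n hn, hg.2 n hn]
    · rw [fourierCoeff_cauchyProj f hn, h n hn]

theorem coeFn_one :
    ((ContinuousMap.toLp 2 circMeas ℂ (1 : C(Circ, ℂ)) : L2T) : Circ → ℂ) =ᵐ[circMeas]
      fun _ => 1 :=
  ContinuousMap.coeFn_toLp (p := 2) (𝕜 := ℂ) circMeas (1 : C(Circ, ℂ))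

theorem fourierCoeff_one (n : ℤ) :
    fourierCoeff (ContinuousMap.toLp 2 circMeas ℂ (1 : C(Circ, ℂ)) : L2T) n =
      if n = 0 then 1 else 0 := by
  rw [fourierCoeff_congr_ae coeFn_one, fourierCoeff_const]

theorem norm_star_sub_star (f g : L2T) : ‖star f - star g‖ = ‖f - g‖ := by
  refine le_antisymm ?_ ?_
  all_goals
    refine Lp.norm_le_norm_of_ae_le ?_
    filter_upwards [Lp.coeFn_sub (star f) (star g), Lp.coeFn_sub f g, Lp.coeFn_star f,
      Lp.coeFn_star g] with t e1 e2 e3 e4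
    rw [e1, e2, Pi.sub_apply, Pi.sub_apply, e3, e4, Pi.star_apply, Pi.star_apply, ← star_sub,
      norm_star]

namespace IsBPair

variable {a b : L2T} {s : ℝ} (h : IsBPair a b s)
include h

theorem coeFn_mulL2 (f : L2T) :
    mulL2 (fun t => b t / a t) f =ᵐ[circMeas] fun t => b t / a t * f t := by
  rw [mulL2, dif_pos (h.memLp_ratio_mul (Lp.memLp f))]
  exact MemLp.coeFn_toLp _

theorem norm_mulL2_sub_le (f g : L2T) :
    ‖mulL2 (fun t => b t / a t) f - mulL2 (fun t => b t / a t) g‖ ≤ s * ‖f - g‖ := by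
  refine norm_le_mul_of_ae (Lp.coeFn_sub _ _) (Lp.coeFn_sub _ _) ?_
  filter_upwards [h.coeFn_mulL2 f, h.coeFn_mulL2 g, h.ratio_le] with t e1 e2 e3
  rw [Pi.sub_apply, Pi.sub_apply, e1, e2, ← mul_sub, norm_mul]
  gcongr

theorem norm_cauchyProj_mulL2_sub_le (f g : L2T) :
    ‖cauchyProj (mulL2 (fun t => b t / a t) f) - cauchyProj (mulL2 (fun t => b t / a t) g)‖ ≤
      s * ‖f - g‖ := by
  rw [← map_sub]
  exact (hardySubmodule.norm_starProjection_apply_le _).trans (h.norm_mulL2_sub_le f g)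

theorem eLpNorm_ratio_lt_one : eLpNorm (fun t => b t / a t) ∞ circMeas < 1 := by
  rw [eLpNorm_exponent_top]
  refine (eLpNormEssSup_le_of_ae_bound h.ratio_le).trans_lt ?_
  rw [ENNReal.ofReal_lt_one]
  exact h.lt_one

/-- Each component of the image depends on only one component of the argument. Multiplication by
`b/a` contracts by `s`, while the projection and conjugation do not increase distances. -/
theorem contractingWith : ContractingWith ⟨s, h.nonneg⟩ (fixedPointMap a b) := by
  refine ⟨by exact_mod_cast h.lt_one, LipschitzWith.of_dist_le_mul fun X Y => ?_⟩
  rw [dist_eq_norm, dist_eq_norm]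
  refine le_of_sq_le_sq ?_ (mul_nonneg h.nonneg (norm_nonneg _))
  rw [mul_pow, WithLp.prod_norm_sq_eq_of_L2, WithLp.prod_norm_sq_eq_of_L2]
  have h1 := h.norm_cauchyProj_mulL2_sub_le X.fst Y.fst
  have h2 := h.norm_cauchyProj_mulL2_sub_le (star X.snd) (star Y.snd)
  rw [norm_star_sub_star] at h2
  have e1 : ‖(fixedPointMap a b X - fixedPointMap a b Y).fst‖ ≤ s * ‖X.snd - Y.snd‖ := by
    change ‖star _ - star _‖ ≤ _
    rw [norm_star_sub_star, sub_sub_sub_cancel_left, norm_sub_rev]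
    exact h2
  have e2 : ‖(fixedPointMap a b X - fixedPointMap a b Y).snd‖ ≤ s * ‖X.fst - Y.fst‖ := h1
  have e3 := pow_le_pow_left₀ (norm_nonneg _) e1 2
  have e4 := pow_le_pow_left₀ (norm_nonneg _) e2 2
  change _ ≤ s ^ 2 * (‖X.fst - Y.fst‖ ^ 2 + ‖X.snd - Y.snd‖ ^ 2)
  rw [mul_pow] at e3 e4
  linarith

/-- The equation `P_𝔻((b/a) B^*) = 1 - A^*` splits by frequency: for `n ≥ 0` it says that `A^* +
(b/a) B^*` has the coefficients of `1`, for `n < 0` that those of `A^*` vanish. The equation for `B`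
splits in the same way. -/
theorem fixedPointMap_eq_iff (A B : L2T) :
    fixedPointMap a b (WithLp.toLp 2 (A, B)) = WithLp.toLp 2 (A, B) ↔ FixedEqs a b A B := by
  have hstar : ∀ f : L2T, (fun t => star (f t)) =ᵐ[circMeas] (star f : L2T) := fun f =>
    (Lp.coeFn_star f).symm
  have hM1 : ∀ n, fourierCoeff (fun t => star (A t) + b t / a t * star (B t)) n =
      fourierCoeff (star A : L2T) n +
        fourierCoeff (mulL2 (fun t => b t / a t) (star B)) n := fun n => by
    rw [← fourierCoeff_add (Lp.memLp _) (Lp.memLp _)]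
    refine congrFun (fourierCoeff_congr_ae ?_) n
    filter_upwards [h.coeFn_mulL2 (star B), hstar A, hstar B] with t e1 e2 e3
    rw [e1, e2, e3]
  have hM2 : ∀ n, fourierCoeff (fun t => B t - b t / a t * A t) n =
      fourierCoeff B n - fourierCoeff (mulL2 (fun t => b t / a t) A) n := fun n => by
    rw [← fourierCoeff_sub (Lp.memLp _) (Lp.memLp _)]
    refine congrFun (fourierCoeff_congr_ae ?_) n
    filter_upwards [h.coeFn_mulL2 A] with t e1
    rw [e1]
  have hN1 : MemLp (fun t => star (A t) + b t / a t * star (B t)) 2 circMeas :=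
    (Lp.memLp A).star.add (h.memLp_ratio_mul (Lp.memLp B).star)
  have hN2 : MemLp (fun t => B t - b t / a t * A t) 2 circMeas :=
    (Lp.memLp B).sub (h.memLp_ratio_mul (Lp.memLp A))
  have hiff : fixedPointMap a b (WithLp.toLp 2 (A, B)) = WithLp.toLp 2 (A, B) ↔
      cauchyProj (mulL2 (fun t => b t / a t) (star B)) =
        ContinuousMap.toLp 2 circMeas ℂ (1 : C(Circ, ℂ)) - star A ∧
      cauchyProj (mulL2 (fun t => b t / a t) A) = B := by
    rw [fixedPointMap, (WithLp.toLp_injective 2).eq_iff, Prod.mk.injEq]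
    refine and_congr ?_ Iff.rfl
    change star (_ - cauchyProj (mulL2 (fun t => b t / a t) (star B))) = A ↔ _
    rw [star_eq_iff_star_eq, eq_comm, sub_eq_iff_eq_add, eq_sub_iff_add_eq, eq_comm, add_comm]
  have hsub : ∀ n, fourierCoeff
      (ContinuousMap.toLp 2 circMeas ℂ (1 : C(Circ, ℂ)) - star A : L2T) n =
      (if n = 0 then 1 else 0) - fourierCoeff (star A : L2T) n := fun n => by
    rw [fourierCoeff_congr_ae (Lp.coeFn_sub _ _), ← fourierCoeff_one]
    exact fourierCoeff_sub (Lp.memLp _) (Lp.memLp _) n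
  rw [hiff, cauchyProj_eq_iff, cauchyProj_eq_iff]
  constructor
  · rintro ⟨⟨h1, h2⟩, h3, h4⟩
    have key1 : ∀ n : ℤ, 0 ≤ n →
        fourierCoeff (fun t => star (A t) + b t / a t * star (B t)) n = if n = 0 then 1 else 0 :=
      fun n hn => by rw [hM1, ← h2 n hn, hsub, add_sub_cancel]
    refine ⟨VanishBelow.congr ⟨Lp.memLp _, fun n hn => ?_⟩ (hstar A).symm, h3,
      VanishBelow.star_of_forall hN1 fun n hn => ?_, ?_,
      VanishBelow.star_of_forall hN2 fun n hn => ?_⟩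
    · have := h1.2 n hn
      rw [hsub, if_neg hn.ne, zero_sub, neg_eq_zero] at this
      exact this
    · rw [key1 n (by omega), if_neg (by omega)]
    · refine (fourierCoeff_zero_star _).trans ?_
      rw [key1 0 le_rfl, if_pos rfl, map_one]
    · rw [hM2, h4 n (by omega), sub_self]
  · intro hF
    have hA : VanishBelow 0 (star A : L2T) := hF.star_A.congr (hstar A)
    refine ⟨⟨⟨Lp.memLp _, fun n hn => ?_⟩, fun n hn => ?_⟩, hF.mem_B, fun n hn => ?_⟩
    · rw [hsub, if_neg hn.ne, hA.2 n hn, sub_zero]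
    · rw [hsub, sub_eq_iff_eq_add', ← hM1]
      split_ifs with h0
      · have := hF.fst_zero
        have h2 := (fourierCoeff_zero_star _).symm.trans this
        rw [h0, ← RCLike.conj_conj (fourierCoeff _ 0), h2, map_one]
      · exact (hF.fst.fourierCoeff_eq_zero_of_star (by omega)).symm
    · rw [← sub_eq_zero, ← hM2]
      exact hF.snd.fourierCoeff_eq_zero_of_star (by omega)

end IsBPair

/-! ### Elements of the spaces of pairs -/

theorem mem_spaceL_iff {p : FunPair} : p ∈ spaceL ↔
    (∀ᵐ t ∂circMeas, p.1 t * star (p.1 t) + p.2 t * star (p.2 t) = 1) ∧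
      VanishBelow 0 (fun t => star (p.1 t)) ∧ (fourierCoeff p.1 0).im = 0 ∧
      0 < (fourierCoeff p.1 0).re := by
  rw [← posAtInfty_iff]
  exact Iff.rfl

theorem NoCommonInnerFactor.congr {u v u' v' : Circ → ℂ} (h : NoCommonInnerFactor u v)
    (hu : u =ᵐ[circMeas] u') (hv : v =ᵐ[circMeas] v') : NoCommonInnerFactor u' v' := by
  intro g hg h1 h2
  refine h g hg (VanishBelow.congr h1 ?_) (VanishBelow.congr h2 ?_)
  · filter_upwards [hu] with t ht
    rw [ht]
  · filter_upwards [hv] with t ht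
    rw [ht]

theorem mem_spaceH_iff {p : FunPair} : p ∈ spaceH ↔
    p ∈ spaceL ∧ VanishBelow 0 p.2 ∧ NoCommonInnerFactor (fun t => star (p.1 t)) p.2 := Iff.rfl

theorem mem_spaceH0Star_iff {p : FunPair} : p ∈ spaceH0Star ↔
    p ∈ spaceL ∧ VanishBelow 1 (fun t => star (p.2 t)) ∧
      NoCommonInnerFactor (fun t => star (p.1 t)) (fun t => star (p.2 t)) := by
  have hs : ((star p.2 : L2T) : Circ → ℂ) =ᵐ[circMeas] fun t => star (p.2 t) := Lp.coeFn_star p.2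
  constructor
  · rintro ⟨h1, ⟨h2, h3, h4⟩, h5⟩
    rw [discVal_zero] at h5
    refine ⟨h1, VanishBelow.succ (VanishBelow.congr h3 hs) h5, h4.congr (ae_eq_refl _) hs⟩
  · rintro ⟨h1, h2, h3⟩
    refine ⟨h1, ⟨?_, (h2.mono (by omega)).congr hs.symm, h3.congr (ae_eq_refl _) hs.symm⟩, ?_⟩
    · rw [mem_spaceL_iff] at h1 ⊢
      refine ⟨?_, h1.2⟩
      filter_upwards [h1.1, hs] with t e1 e2
      rw [e2, star_star, mul_comm (star _)]
      exact e1
    · rw [discVal_zero]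
      exact h2.2 0 (by omega)

theorem isProd_iff {p q r : FunPair} : IsProd p q r ↔
    (∀ᵐ t ∂circMeas, p.1 t * q.1 t - p.2 t * star (q.2 t) = r.1 t) ∧
      ∀ᵐ t ∂circMeas, p.1 t * q.2 t + p.2 t * star (q.1 t) = r.2 t := by
  rw [← eventually_and]
  simp only [IsProd, mulSU2, Prod.mk.injEq]

theorem isFactorization_of_mem {a b am bm ap bp : L2T} (hm : (am, bm) ∈ spaceL)
    (hbm : VanishBelow 1 (fun t => star (bm t))) (hp : (ap, bp) ∈ spaceL)
    (hbp : VanishBelow 0 bp) (h : IsProd (am, bm) (ap, bp) (a, b)) :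
    IsFactorization a b am bm ap bp := by
  rw [mem_spaceL_iff] at hm hp
  rw [isProd_iff] at h
  exact ⟨hp.1, hm.1, hp.2.1, hbp, hm.2.1, hbm, hp.2.2.1, hp.2.2.2, hm.2.2.1, hm.2.2.2, h.1, h.2⟩

namespace IsFactorization

variable {a b : Circ → ℂ} {am bm ap bp : L2T} {s : ℝ}

/-- The conjugated first entry of the product, `a^* = a_-^* a_+^* - b_-^* b_+`, is a Bezout identity
for `a_+^*` and `b_+` with bounded analytic coefficients. -/
theorem mem_spaceH (hab : IsBPair a b s) (h : IsFactorization a b am bm ap bp) :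
    (ap, bp) ∈ spaceH := by
  rw [mem_spaceH_iff, mem_spaceL_iff]
  refine ⟨⟨h.unit_p, h.star_ap, h.im_ap, h.re_ap⟩, h.mem_bp,
    noCommonInnerFactor_of_bezout (α := fun t => star (a t)) (p := fun t => star (am t))
      (q := fun t => star (bm t)) (M := 2) ?_ h.star_am ?_ (h.star_bm.mono (by omega)) ?_
      hab.inv_star_a hab.inv_le ?_⟩
  · filter_upwards [h.fst] with t e
    rw [← e]
    simp only [star_sub, star_mul', star_star]
  · filter_upwards [h.unit_m] with t e
    rw [norm_star]
    exact (norm_le_one_of_unit e).1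
  · filter_upwards [h.unit_m] with t e
    rw [norm_star]
    exact (norm_le_one_of_unit e).2
  · filter_upwards [hab.ne_zero] with t e
    exact star_ne_zero.mpr e

/-- The same identity, read with `a_+^*` and `b_+` as the coefficients. -/
theorem mem_spaceH0Star (hab : IsBPair a b s) (h : IsFactorization a b am bm ap bp) :
    (am, bm) ∈ spaceH0Star := by
  rw [mem_spaceH0Star_iff, mem_spaceL_iff]
  refine ⟨⟨h.unit_m, h.star_am, h.im_am, h.re_am⟩, h.star_bm,
    noCommonInnerFactor_of_bezout (α := fun t => star (a t)) (p := fun t => star (ap t))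
      (q := bp) (M := 2) ?_ h.star_ap ?_ h.mem_bp ?_ hab.inv_star_a hab.inv_le ?_⟩
  · filter_upwards [h.fst] with t e
    rw [← e]
    simp only [star_sub, star_mul', star_star]
    ring
  · filter_upwards [h.unit_p] with t e
    rw [norm_star]
    exact (norm_le_one_of_unit e).1
  · filter_upwards [h.unit_p] with t e
    exact (norm_le_one_of_unit e).2
  · filter_upwards [hab.ne_zero] with t e
    exact star_ne_zero.mpr e

end IsFactorization

theorem IsFactorization.congr {a b am bm ap bp am' bm' ap' bp' : Circ → ℂ}
    (h : IsFactorization a b am bm ap bp) (h1 : am =ᵐ[circMeas] am') (h2 : bm =ᵐ[circMeas] bm')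
    (h3 : ap =ᵐ[circMeas] ap') (h4 : bp =ᵐ[circMeas] bp') :
    IsFactorization a b am' bm' ap' bp' where
  unit_p := by filter_upwards [h.unit_p, h3, h4] with t e e3 e4; rwa [← e3, ← e4]
  unit_m := by filter_upwards [h.unit_m, h1, h2] with t e e1 e2; rwa [← e1, ← e2]
  star_ap := h.star_ap.congr (by filter_upwards [h3] with t e; rw [e])
  mem_bp := h.mem_bp.congr h4
  star_am := h.star_am.congr (by filter_upwards [h1] with t e; rw [e])
  star_bm := h.star_bm.congr (by filter_upwards [h2] with t e; rw [e])
  im_ap := by rw [← fourierCoeff_congr_ae h3]; exact h.im_ap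
  re_ap := by rw [← fourierCoeff_congr_ae h3]; exact h.re_ap
  im_am := by rw [← fourierCoeff_congr_ae h1]; exact h.im_am
  re_am := by rw [← fourierCoeff_congr_ae h1]; exact h.re_am
  fst := by
    filter_upwards [h.fst, h1, h2, h3, h4] with t e e1 e2 e3 e4; rwa [← e1, ← e2, ← e3, ← e4]
  snd := by
    filter_upwards [h.snd, h1, h2, h3, h4] with t e e1 e2 e3 e4; rwa [← e1, ← e2, ← e3, ← e4]

theorem FixedEqs.congr {a b A B A' B' : Circ → ℂ} (h : FixedEqs a b A B)
    (hA : A =ᵐ[circMeas] A') (hB : B =ᵐ[circMeas] B') : FixedEqs a b A' B' where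
  star_A := h.star_A.congr (by filter_upwards [hA] with t e; rw [e])
  mem_B := h.mem_B.congr hB
  fst := h.fst.congr (by filter_upwards [hA, hB] with t e1 e2; rw [e1, e2])
  fst_zero := by
    rw [← h.fst_zero]
    refine congrFun (fourierCoeff_congr_ae ?_) 0
    filter_upwards [hA, hB] with t e1 e2; rw [e1, e2]
  snd := h.snd.congr (by filter_upwards [hA, hB] with t e1 e2; rw [e1, e2])

/-! ### The factorization theorem -/

/-- The fixed point yields a factorization. -/
theorem exists_isFactorization {a b A B : L2T} {s : ℝ} (hab : IsBPair a b s)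
    (h : FixedEqs a b A B) : ∃ am bm ap bp : L2T, IsFactorization a b am bm ap bp := by
  have hf := h.isFactorization hab
  exact ⟨(memLp_of_star hf.star_am.1).toLp _, (memLp_of_star hf.star_bm.1).toLp _,
    (memLp_of_star hf.star_ap.1).toLp _, hf.mem_bp.1.toLp _,
    hf.congr (MemLp.coeFn_toLp _).symm (MemLp.coeFn_toLp _).symm (MemLp.coeFn_toLp _).symm
      (MemLp.coeFn_toLp _).symm⟩

/-- The right factor of a factorization is the normalized fixed point. -/
theorem IsFactorization.eq_smul {a b A B am bm ap bp : L2T} {s : ℝ} (hab : IsBPair a b s)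
    (hAB : ∀ X : HilbPair, fixedPointMap a b X = X → X = WithLp.toLp 2 (A, B))
    (h : IsFactorization a b am bm ap bp) :
    ap = (((Real.sqrt (valInfty A).re)⁻¹ : ℝ) : ℂ) • A ∧
      bp = (((Real.sqrt (valInfty A).re)⁻¹ : ℝ) : ℂ) • B := by
  set γ := fourierCoeff ap 0 with hγ
  have hf := (h.fixedEqs hab).congr (Lp.coeFn_smul γ ap).symm (Lp.coeFn_smul γ bp).symm
  have e := hAB _ ((hab.fixedPointMap_eq_iff _ _).mpr hf)
  rw [(WithLp.toLp_injective 2).eq_iff, Prod.mk.injEq] at e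
  have hγr : γ = ((γ.re : ℝ) : ℂ) := Complex.ext (by simp) (by simpa using h.im_ap)
  -- As `A = γ a_+` with `γ = a_+(∞)`, one has `A(∞) = γ²`; so scaling by `A(∞)^{-1/2}` undoes the
  -- scaling by `γ`.
  have hval : valInfty A = ((γ.re ^ 2 : ℝ) : ℂ) := by
    rw [valInfty_eq, ← e.1, fourierCoeff_congr_ae (Lp.coeFn_smul γ ap), fourierCoeff.const_smul,
      ← hγ, smul_eq_mul, Complex.ofReal_pow, ← hγr, sq]
  have hc : (((Real.sqrt (valInfty A).re)⁻¹ : ℝ) : ℂ) = γ⁻¹ := by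
    rw [hval, Complex.ofReal_re, Real.sqrt_sq h.re_ap.le, Complex.ofReal_inv, ← hγr]
  have hγ0 : γ ≠ 0 := fun h0 => by
    have := h.re_ap
    rw [← hγ, h0] at this
    simp at this
  rw [hc, ← e.1, ← e.2, inv_smul_smul₀ hγ0, inv_smul_smul₀ hγ0]
  exact ⟨rfl, rfl⟩

theorem IsFactorization.isProd {a b am bm ap bp : L2T} (h : IsFactorization a b am bm ap bp) :
    IsProd (a, b) (star ap, -bp) (am, bm) := by
  rw [isProd_iff, ← eventually_and]
  filter_upwards [h.eq_mul, Lp.coeFn_star ap, Lp.coeFn_neg bp] with t e e1 e2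
  rw [e1, e2]
  simp only [Pi.star_apply, Pi.neg_apply, star_star, star_neg]
  rw [← e.1, ← e.2]
  constructor <;> ring

/-- Both right factors are the same multiple of the unique fixed point, and the right factor
determines the left one. Only supports and normalizations enter, no condition on inner factors. -/
theorem IsFactorization.unique {a b am bm ap bp am' bm' ap' bp' : L2T} {s : ℝ}
    (hab : IsBPair a b s) (h : IsFactorization a b am bm ap bp)
    (h' : IsFactorization a b am' bm' ap' bp') :
    ((am, bm), (ap, bp)) = ((am', bm'), (ap', bp')) := by
  have hfix : ∀ X : HilbPair, fixedPointMap a b X = X →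
      X = WithLp.toLp 2 ((hab.contractingWith.fixedPoint (fixedPointMap a b)).fst,
        (hab.contractingWith.fixedPoint (fixedPointMap a b)).snd) := fun X hX =>
    hab.contractingWith.fixedPoint_unique hX
  have e1 := h.eq_smul hab hfix
  have e2 := h'.eq_smul hab hfix
  obtain rfl : ap = ap' := e1.1.trans e2.1.symm
  obtain rfl : bp = bp' := e1.2.trans e2.2.symm
  have e3 := h.eq_mul
  have e4 := h'.eq_mul
  obtain rfl : am = am' := Lp.ext (by
    filter_upwards [e3, e4] with t f1 f2
    rw [← f1.1, ← f2.1])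
  obtain rfl : bm = bm' := Lp.ext (by
    filter_upwards [e3, e4] with t f1 f2
    rw [← f1.2, ← f2.2])
  rfl

/-! ### The algebra of pairs -/

section Algebra

variable {R : Type*} [CommRing R] [StarRing R]

theorem mulSU2_assoc (p q r : R × R) : mulSU2 (mulSU2 p q) r = mulSU2 p (mulSU2 q r) := by
  ext <;> simp only [mulSU2, star_add, star_sub, star_mul', star_star] <;> ring

theorem one_mulSU2 (p : R × R) : mulSU2 (1, 0) p = p := by
  ext <;> simp [mulSU2]

theorem mulSU2_one (p : R × R) : mulSU2 p (1, 0) = p := by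
  ext <;> simp [mulSU2]

/-- The inverse of a pair with determinant one. -/
def invSU2 (p : R × R) : R × R := (star p.1, -p.2)

/-- The determinant of a pair. -/
def detSU2 (p : R × R) : R := p.1 * star p.1 + p.2 * star p.2

theorem detSU2_mulSU2 (p q : R × R) : detSU2 (mulSU2 p q) = detSU2 p * detSU2 q := by
  simp only [detSU2, mulSU2, star_add, star_sub, star_mul', star_star]
  ring

theorem invSU2_mulSU2 {p : R × R} (h : detSU2 p = 1) : mulSU2 (invSU2 p) p = (1, 0) := by
  rw [← h]
  ext <;> simp only [detSU2, invSU2, mulSU2] <;> ring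

theorem mulSU2_invSU2 {p : R × R} (h : detSU2 p = 1) : mulSU2 p (invSU2 p) = (1, 0) := by
  rw [← h]
  ext <;> simp only [detSU2, invSU2, mulSU2, star_neg, star_star] <;> ring

/-- The anti-automorphism `(a, b) ↦ (a, b^*)`. -/
def flipSU2 (p : R × R) : R × R := (p.1, star p.2)

theorem flipSU2_mulSU2 (p q : R × R) :
    flipSU2 (mulSU2 p q) = mulSU2 (flipSU2 q) (flipSU2 p) := by
  ext <;> simp only [flipSU2, mulSU2, star_add, star_mul', star_star] <;> ring

end Algebra

/-! ### Partial products -/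

/-- The normalizing constant `(1 + |f|²)^{-1/2}`. -/
noncomputable def normConst (f : ℂ) : ℝ := (Real.sqrt (1 + ‖f‖ ^ 2))⁻¹

theorem normConst_pos (f : ℂ) : 0 < normConst f := by
  unfold normConst
  positivity

theorem normConst_sq (f : ℂ) : normConst f ^ 2 * (1 + ‖f‖ ^ 2) = 1 := by
  have : 0 < 1 + ‖f‖ ^ 2 := by positivity
  rw [normConst, inv_pow, Real.sq_sqrt this.le, inv_mul_cancel₀ this.ne']

theorem normConst_le_one (f : ℂ) : normConst f ≤ 1 := by
  have h1 := normConst_sq f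
  have h2 := normConst_pos f
  nlinarith [sq_nonneg ‖f‖, mul_nonneg (sq_nonneg (normConst f)) (sq_nonneg ‖f‖)]

theorem normConst_sq' (f : ℂ) : (normConst f : ℂ) ^ 2 * (1 + f * star f) = 1 := by
  have := normConst_sq f
  rw [Complex.star_def, Complex.mul_conj']
  exact_mod_cast this

theorem factor_fst_apply (F : ℤ → ℂ) (k : ℤ) (t : Circ) :
    (factor F k).1 t = normConst (F k) := by
  simp [factor, normConst]

theorem factor_snd_apply (F : ℤ → ℂ) (k : ℤ) (t : Circ) :
    (factor F k).2 t = normConst (F k) * (F k * fourier k t) := by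
  rfl

theorem fourier_mul_star (k : ℤ) (t : Circ) : fourier k t * star (fourier k t) = 1 := by
  rw [Complex.star_def, Complex.mul_conj', norm_fourier_apply]
  norm_num

theorem star_fourier (k : ℤ) (t : Circ) : star (fourier k t) = fourier (-k) t := by
  rw [fourier_neg]
  rfl

theorem detSU2_factor (F : ℤ → ℂ) (k : ℤ) : detSU2 (factor F k) = 1 := by
  ext t
  change (factor F k).1 t * star ((factor F k).1 t) + (factor F k).2 t * star ((factor F k).2 t) = 1
  rw [factor_fst_apply, factor_snd_apply]
  have h : star (normConst (F k) : ℂ) = normConst (F k) := Complex.conj_ofReal _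
  have h2 := fourier_mul_star k t
  simp only [star_mul', h]
  linear_combination normConst_sq' (F k) + (normConst (F k) : ℂ) ^ 2 * F k * star (F k) * h2

theorem detSU2_partialProd (F : ℤ → ℂ) (M : ℤ) (n : ℕ) : detSU2 (partialProd F M n) = 1 := by
  induction n with
  | zero => simp [partialProd, detSU2]
  | succ n ih => rw [partialProd, detSU2_mulSU2, ih, detSU2_factor, one_mul]

theorem partialProd_add (F : ℤ → ℂ) (M : ℤ) (m n : ℕ) :
    partialProd F M (m + n) = mulSU2 (partialProd F M m) (partialProd F (M + m) n) := by
  induction n with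
  | zero => exact (mulSU2_one _).symm
  | succ n ih =>
    rw [← add_assoc, partialProd, ih, partialProd, mulSU2_assoc]
    push_cast
    rw [add_assoc]

theorem partialProd_succ' (F : ℤ → ℂ) (M : ℤ) (n : ℕ) :
    partialProd F M (n + 1) = mulSU2 (factor F M) (partialProd F (M + 1) n) := by
  rw [add_comm, partialProd_add]
  simp [partialProd, one_mulSU2]

theorem partialProd_congr {F F' : ℤ → ℂ} {M : ℤ} {n : ℕ}
    (h : ∀ k, M ≤ k → k < M + n → F k = F' k) : partialProd F M n = partialProd F' M n := by
  induction n with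
  | zero => rfl
  | succ n ih =>
    rw [partialProd, partialProd, ih fun k h1 h2 => h k h1 (by push_cast; omega), factor, factor,
      h (M + n) (by omega) (by push_cast; omega)]

/-- A pair of continuous functions as a pair of functions. -/
noncomputable def coePair (p : C(Circ, ℂ) × C(Circ, ℂ)) : (Circ → ℂ) × (Circ → ℂ) := (p.1, p.2)

theorem coePair_mulSU2 (p q : C(Circ, ℂ) × C(Circ, ℂ)) :
    coePair (mulSU2 p q) = mulSU2 (coePair p) (coePair q) := rfl

theorem coePair_one : coePair (1, 0) = (1, 0) := rfl

theorem detSU2_coePair (p : C(Circ, ℂ) × C(Circ, ℂ)) (h : detSU2 p = 1) :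
    detSU2 (coePair p) = 1 := by
  funext t
  exact congrArg (fun φ : C(Circ, ℂ) => φ t) h

/-! ### Layers -/

/-- Pairs with determinant one, `a ∈ H²(𝔻^*)` and `b` with Fourier support in `[m, ∞)`. -/
structure IsLayer (m : ℤ) (p : (Circ → ℂ) × (Circ → ℂ)) : Prop where
  unit : ∀ᵐ t ∂circMeas, p.1 t * star (p.1 t) + p.2 t * star (p.2 t) = 1
  star_fst : VanishBelow 0 (fun t => star (p.1 t))
  snd : VanishBelow m p.2

namespace IsLayer

variable {m : ℤ} {p : (Circ → ℂ) × (Circ → ℂ)}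

theorem memLp_fst (h : IsLayer m p) : MemLp p.1 2 circMeas := memLp_of_star h.star_fst.1

theorem congr {q : (Circ → ℂ) × (Circ → ℂ)} (h : IsLayer m p) (h1 : p.1 =ᵐ[circMeas] q.1)
    (h2 : p.2 =ᵐ[circMeas] q.2) : IsLayer m q where
  unit := by filter_upwards [h.unit, h1, h2] with t e e1 e2; rwa [← e1, ← e2]
  star_fst := h.star_fst.congr (by filter_upwards [h1] with t e; rw [e])
  snd := h.snd.congr h2

theorem re_le_one (h : IsLayer m p) : (fourierCoeff p.1 0).re ≤ 1 := by
  refine (Complex.re_le_norm _).trans (norm_fourierCoeff_le_one ?_ 0)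
  filter_upwards [h.unit] with t ht
  exact (norm_le_one_of_unit ht).1

/-- Supports are preserved because `z^m a^*` starts at `m` and `z^{-m} b` at `0`. The leading
coefficients `(a(∞), b̂(m))` are themselves multiplied on the left by the constant pair `c (1, F
m)`. -/
theorem mul_factor (h : IsLayer m p) (F : ℤ → ℂ) :
    IsLayer m (mulSU2 (coePair (factor F m)) p) ∧
    fourierCoeff (mulSU2 (coePair (factor F m)) p).1 0 =
      normConst (F m) * (fourierCoeff p.1 0 - F m * star (fourierCoeff p.2 m)) ∧
    fourierCoeff (mulSU2 (coePair (factor F m)) p).2 m =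
      normConst (F m) * (fourierCoeff p.2 m + F m * star (fourierCoeff p.1 0)) := by
  set c := normConst (F m)
  set f := F m
  have hc : star (c : ℂ) = c := Complex.conj_ofReal _
  have e1 : ∀ t, (mulSU2 (coePair (factor F m)) p).1 t =
      c * p.1 t - c * (f * fourier m t) * star (p.2 t) := fun t => by
    change (factor F m).1 t * p.1 t - (factor F m).2 t * star (p.2 t) = _
    rw [factor_fst_apply, factor_snd_apply]
  have e2 : ∀ t, (mulSU2 (coePair (factor F m)) p).2 t =
      c * (p.2 t + f * (fourier m t * star (p.1 t))) := fun t => by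
    change (factor F m).1 t * p.2 t + (factor F m).2 t * star (p.1 t) = _
    rw [factor_fst_apply, factor_snd_apply]
    ring
  have e1' : ∀ t, star ((mulSU2 (coePair (factor F m)) p).1 t) =
      c * (star (p.1 t) - star f * (fourier (-m) t * p.2 t)) := fun t => by
    rw [e1, ← star_fourier]
    simp only [star_sub, star_mul', star_star, hc]
    ring
  have v1 := (h.snd.fourier_mul (-m)).const_mul (star f)
  have v2 := (h.star_fst.fourier_mul m).const_mul f
  rw [add_neg_cancel] at v1
  rw [zero_add] at v2
  have w1 := (h.star_fst.sub v1).const_mul c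
  have w2 := (h.snd.add v2).const_mul c
  have k0 : fourierCoeff (fun t => star (p.1 t)) 0 = star (fourierCoeff p.1 0) :=
    fourierCoeff_zero_star p.1
  refine ⟨⟨?_, w1.congr (ae_of_all _ fun t => (e1' t).symm),
    w2.congr (ae_of_all _ fun t => (e2 t).symm)⟩, ?_, ?_⟩
  · filter_upwards [h.unit] with t ht
    have hd := congrFun (detSU2_mulSU2 (coePair (factor F m)) p) t
    rw [detSU2_coePair _ (detSU2_factor F m), one_mul] at hd
    exact hd.trans ht
  · have := fourierCoeff_zero_star (mulSU2 (coePair (factor F m)) p).1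
    change fourierCoeff (fun t => star ((mulSU2 (coePair (factor F m)) p).1 t)) 0 = _ at this
    rw [← RCLike.conj_conj (fourierCoeff _ 0), ← this,
      fourierCoeff_congr_ae (ae_of_all _ e1'), fourierCoeff.const_mul,
      fourierCoeff_sub h.star_fst.1 v1.1, fourierCoeff.const_mul, fourierCoeff_fourier_mul, k0,
      ← Complex.star_def]
    simp only [star_sub, star_mul', star_star, hc, sub_neg_eq_add, zero_add]
  · rw [fourierCoeff_congr_ae (ae_of_all _ e2), fourierCoeff.const_mul,
      fourierCoeff_add h.snd.1 v2.1, fourierCoeff.const_mul, fourierCoeff_fourier_mul, sub_self, k0]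

end IsLayer

/-- The value at infinity of a partial product. -/
noncomputable def prodConst (F : ℤ → ℂ) (M : ℤ) (n : ℕ) : ℝ :=
  ∏ j ∈ Finset.range n, normConst (F (M + j))

theorem prodConst_pos (F : ℤ → ℂ) (M : ℤ) (n : ℕ) : 0 < prodConst F M n :=
  Finset.prod_pos fun _ _ => normConst_pos _

theorem prodConst_add (F : ℤ → ℂ) (M : ℤ) (m n : ℕ) :
    prodConst F M (m + n) = prodConst F M m * prodConst F (M + m) n := by
  simp only [prodConst, Finset.prod_range_add, Nat.cast_add, add_assoc]

/-- Factors are added on the left. The product already formed starts at frequency `M + 1`, so its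
`M`-th coefficient vanishes and `a(∞)` is just multiplied by the normalizing constant. -/
theorem isLayer_partialProd (F : ℤ → ℂ) (M : ℤ) (n : ℕ) :
    IsLayer M (coePair (partialProd F M n)) ∧
      fourierCoeff (partialProd F M n).1 0 = prodConst F M n := by
  induction n generalizing M with
  | zero =>
    have h1 : fourierCoeff (fun _ : Circ => (0 : ℂ)) = fun _ => 0 := by
      funext n; simp [fourierCoeff_const]
    refine ⟨⟨ae_of_all _ fun t => ?_, ?_, memLp_const 0, fun k _ => congrFun h1 k⟩, ?_⟩
    · simp [coePair, partialProd]
    · refine (VanishBelow.const 1).congr (ae_of_all _ fun t => ?_)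
      simp [coePair, partialProd]
    · have : fourierCoeff (fun _ : Circ => (1 : ℂ)) 0 = 1 := by simpa using fourierCoeff_const 1 0
      rw [prodConst, Finset.prod_range_zero, Complex.ofReal_one]
      exact this
  | succ n ih =>
    obtain ⟨h1, h2⟩ := ih (M + 1)
    obtain ⟨k1, k2, -⟩ := IsLayer.mul_factor (m := M) ⟨h1.unit, h1.star_fst, h1.snd.mono (by omega)⟩ F
    rw [partialProd_succ']
    refine ⟨k1, k2.trans ?_⟩
    rw [h1.snd.2 M (by omega), star_zero, mul_zero, sub_zero, add_comm n 1, prodConst_add]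
    change _ * fourierCoeff (partialProd F (M + 1) n).1 0 = _
    rw [h2]
    simp [prodConst]

theorem fourierCoeff_partialProd_snd (F : ℤ → ℂ) (M : ℤ) (n : ℕ) :
    fourierCoeff (partialProd F M (n + 1)).2 M = F M * prodConst F M (n + 1) := by
  obtain ⟨h1, h2⟩ := isLayer_partialProd F (M + 1) n
  obtain ⟨-, -, k3⟩ := IsLayer.mul_factor (m := M) ⟨h1.unit, h1.star_fst, h1.snd.mono (by omega)⟩ F
  rw [partialProd_succ']
  refine k3.trans ?_
  rw [h1.snd.2 M (by omega), zero_add, add_comm n 1, prodConst_add]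
  change _ * (_ * star (fourierCoeff (partialProd F (M + 1) n).1 0)) = _
  rw [h2, Complex.star_def, Complex.conj_ofReal]
  simp only [prodConst, Finset.prod_range_one, Nat.cast_zero, add_zero, Nat.cast_one,
    Complex.ofReal_mul]
  ring

/-! ### Distances between products -/

theorem detSU2_eq (p : ℂ × ℂ) : detSU2 p = ((‖p.1‖ ^ 2 + ‖p.2‖ ^ 2 : ℝ) : ℂ) := by
  rw [detSU2, Complex.star_def, Complex.mul_conj', Complex.mul_conj']
  norm_cast

theorem norm_sq_sub_one {p : ℂ × ℂ} (hp : detSU2 p = 1) :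
    ‖p.1 - 1‖ ^ 2 + ‖p.2‖ ^ 2 = 2 - 2 * p.1.re := by
  rw [detSU2_eq, Complex.ofReal_eq_one] at hp
  rw [← Complex.normSq_eq_norm_sq, Complex.normSq_apply] at hp ⊢
  simp only [Complex.sub_re, Complex.one_re, Complex.sub_im, Complex.one_im, sub_zero]
  linear_combination hp

theorem norm_sq_mulSU2 (p q : ℂ × ℂ) : ‖(mulSU2 p q).1‖ ^ 2 + ‖(mulSU2 p q).2‖ ^ 2 =
    (‖p.1‖ ^ 2 + ‖p.2‖ ^ 2) * (‖q.1‖ ^ 2 + ‖q.2‖ ^ 2) := by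
  have := detSU2_mulSU2 p q
  rw [detSU2_eq, detSU2_eq, detSU2_eq] at this
  exact_mod_cast this

/-- Here `p q - q = (p - 1) q`, and the norm `|a|² + |b|²` is multiplicative, being the determinant.
-/
theorem norm_sq_mulSU2_sub_right {p q : ℂ × ℂ} (hp : detSU2 p = 1) (hq : detSU2 q = 1) :
    ‖(mulSU2 p q).1 - q.1‖ ^ 2 + ‖(mulSU2 p q).2 - q.2‖ ^ 2 = 2 - 2 * p.1.re := by
  have h := norm_sq_mulSU2 (p.1 - 1, p.2) q
  rw [norm_sq_sub_one hp] at h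
  rw [detSU2_eq, Complex.ofReal_eq_one] at hq
  rw [hq, mul_one] at h
  rw [← h]
  congr 3 <;> simp only [mulSU2] <;> ring

theorem norm_sq_mulSU2_sub_left {p q : ℂ × ℂ} (hp : detSU2 p = 1) (hq : detSU2 q = 1) :
    ‖(mulSU2 p q).1 - p.1‖ ^ 2 + ‖(mulSU2 p q).2 - p.2‖ ^ 2 = 2 - 2 * q.1.re := by
  have h := norm_sq_mulSU2 p (q.1 - 1, q.2)
  rw [norm_sq_sub_one hq] at h
  rw [detSU2_eq, Complex.ofReal_eq_one] at hp
  rw [hp, one_mul] at h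
  rw [← h]
  congr 3 <;> simp only [mulSU2, star_sub, star_one] <;> ring

theorem norm_sq_add_norm_sq {f g : L2T} {α : Circ → ℂ} (hα : Integrable α circMeas)
    (h : ∀ᵐ t ∂circMeas, ‖f t‖ ^ 2 + ‖g t‖ ^ 2 = 2 - 2 * (α t).re) :
    ‖f‖ ^ 2 + ‖g‖ ^ 2 = 2 - 2 * (fourierCoeff α 0).re := by
  have i : ∀ u : L2T, Integrable (fun t => ‖u t‖ ^ 2) circMeas := fun u =>
    (Lp.memLp u).integrable_norm_pow two_ne_zero
  have i2 : Integrable (fun t => (α t).re) circMeas := hα.re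
  rw [norm_sq_eq_integral, norm_sq_eq_integral, ← integral_add (i f) (i g), integral_congr_ae h,
    integral_sub (integrable_const _) (i2.const_mul 2), integral_const_mul]
  have e : fourierCoeff α 0 = ∫ t, α t ∂circMeas := by
    simp [fourierCoeff]
  have e2 : ∫ t, (α t).re ∂circMeas = (∫ t, α t ∂circMeas).re := integral_re hα
  rw [e, e2]
  simp

/-- A layer as a pair of elements of `L²(𝕋)`. -/
noncomputable def IsLayer.toL {m : ℤ} {p : (Circ → ℂ) × (Circ → ℂ)} (h : IsLayer m p) : FunPair :=
  (h.memLp_fst.toLp _, h.snd.1.toLp _)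

theorem IsLayer.coeFn_fst {m : ℤ} {p : (Circ → ℂ) × (Circ → ℂ)} (h : IsLayer m p) :
    h.toL.1 =ᵐ[circMeas] p.1 := h.memLp_fst.coeFn_toLp

theorem IsLayer.coeFn_snd {m : ℤ} {p : (Circ → ℂ) × (Circ → ℂ)} (h : IsLayer m p) :
    h.toL.2 =ᵐ[circMeas] p.2 := h.snd.1.coeFn_toLp

/-- Integrating the pointwise identity replaces `Re a` by its mean `Re a(∞)`. Thus `L²` distances
between products depend only on a value at infinity of the extra factor. -/
theorem IsLayer.norm_sub_right {k l m : ℤ} {p q r : (Circ → ℂ) × (Circ → ℂ)} (hp : IsLayer k p)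
    (hq : IsLayer l q) (hr : IsLayer m r) (h : r = mulSU2 p q) :
    ‖hr.toL.1 - hq.toL.1‖ ^ 2 + ‖hr.toL.2 - hq.toL.2‖ ^ 2 =
      2 - 2 * (fourierCoeff p.1 0).re := by
  refine norm_sq_add_norm_sq (hp.memLp_fst.integrable one_le_two) ?_
  filter_upwards [hp.unit, hq.unit, hr.coeFn_fst, hr.coeFn_snd, hq.coeFn_fst, hq.coeFn_snd,
    Lp.coeFn_sub hr.toL.1 hq.toL.1, Lp.coeFn_sub hr.toL.2 hq.toL.2] with t e1 e2 e3 e4 e5 e6 e7 e8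
  rw [e7, e8, Pi.sub_apply, Pi.sub_apply, e3, e4, e5, e6, h]
  exact norm_sq_mulSU2_sub_right (p := (p.1 t, p.2 t)) (q := (q.1 t, q.2 t)) e1 e2

theorem IsLayer.norm_sub_left {k l m : ℤ} {p q r : (Circ → ℂ) × (Circ → ℂ)} (hp : IsLayer k p)
    (hq : IsLayer l q) (hr : IsLayer m r) (h : r = mulSU2 p q) :
    ‖hr.toL.1 - hp.toL.1‖ ^ 2 + ‖hr.toL.2 - hp.toL.2‖ ^ 2 =
      2 - 2 * (fourierCoeff q.1 0).re := by
  refine norm_sq_add_norm_sq (hq.memLp_fst.integrable one_le_two) ?_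
  filter_upwards [hp.unit, hq.unit, hr.coeFn_fst, hr.coeFn_snd, hp.coeFn_fst, hp.coeFn_snd,
    Lp.coeFn_sub hr.toL.1 hp.toL.1, Lp.coeFn_sub hr.toL.2 hp.toL.2] with t e1 e2 e3 e4 e5 e6 e7 e8
  rw [e7, e8, Pi.sub_apply, Pi.sub_apply, e3, e4, e5, e6, h]
  exact norm_sq_mulSU2_sub_left (p := (p.1 t, p.2 t)) (q := (q.1 t, q.2 t)) e1 e2

/-! ### Layer stripping -/

theorem invSU2_factor (F : ℤ → ℂ) (k : ℤ) :
    invSU2 (factor F k) = factor (fun j => -F j) k := by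
  have hn : normConst (-F k) = normConst (F k) := by simp [normConst]
  refine Prod.ext (ContinuousMap.ext fun t => ?_) (ContinuousMap.ext fun t => ?_)
  · change star ((factor F k).1 t) = _
    rw [factor_fst_apply, factor_fst_apply, hn]
    exact Complex.conj_ofReal _
  · change -((factor F k).2 t) = _
    rw [factor_snd_apply, factor_snd_apply, hn]
    ring

/-- The pairs obtained from `p` by successively removing the factors on the left. -/
noncomputable def layer (p : (Circ → ℂ) × (Circ → ℂ)) : ℕ → (Circ → ℂ) × (Circ → ℂ)
  | 0 => p
  | n + 1 => mulSU2 (invSU2 (coePair (factor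
      (fun _ => fourierCoeff (layer p n).2 n / fourierCoeff (layer p n).1 0) n))) (layer p n)

/-- The nonlinear Fourier coefficients of `p` on `[0, ∞)`. -/
noncomputable def layerSeq (p : (Circ → ℂ) × (Circ → ℂ)) (k : ℤ) : ℂ :=
  fourierCoeff (layer p k.toNat).2 k.toNat / fourierCoeff (layer p k.toNat).1 0

theorem layer_succ (p : (Circ → ℂ) × (Circ → ℂ)) (n : ℕ) :
    layer p (n + 1) = mulSU2 (coePair (factor (fun j => -layerSeq p j) n)) (layer p n) := by
  rw [← invSU2_factor]
  rfl

theorem layer_eq_mulSU2_factor (p : (Circ → ℂ) × (Circ → ℂ)) (n : ℕ) :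
    layer p n = mulSU2 (coePair (factor (layerSeq p) n)) (layer p (n + 1)) := by
  rw [layer_succ, ← invSU2_factor, ← mulSU2_assoc, ← coePair_mulSU2,
    mulSU2_invSU2 (detSU2_factor _ _), coePair_one, one_mulSU2]

theorem layer_eq_mulSU2 (p : (Circ → ℂ) × (Circ → ℂ)) (m n : ℕ) :
    layer p m = mulSU2 (coePair (partialProd (layerSeq p) m n)) (layer p (m + n)) := by
  induction n with
  | zero => exact (one_mulSU2 _).symm
  | succ n ih =>
    rw [ih, partialProd, coePair_mulSU2, mulSU2_assoc, layer_eq_mulSU2_factor p (m + n)]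
    push_cast
    rfl

/-- With `f = b̂(n)/a(∞)`, removing the factor sends `b̂(n)` to a multiple of `b̂(n) - f a(∞) = 0`,
which raises the support by one. It multiplies `a(∞)` by `c (1 + |f|²) = 1/c`, where `c = (1 +
|f|²)^{-1/2}`. -/
theorem isLayer_layer {p : (Circ → ℂ) × (Circ → ℂ)} {x : ℝ} (hp : IsLayer 0 p)
    (hx : fourierCoeff p.1 0 = x) (hx0 : 0 < x) (n : ℕ) :
    IsLayer n (layer p n) ∧
      fourierCoeff (layer p n).1 0 = ((x / prodConst (layerSeq p) 0 n : ℝ) : ℂ) := by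
  induction n with
  | zero => simpa [layer, prodConst] using ⟨hp, hx⟩
  | succ n ih =>
    obtain ⟨h1, h2⟩ := ih
    set y := x / prodConst (layerSeq p) 0 n with hy
    have hy0 : (y : ℂ) ≠ 0 := by
      exact_mod_cast (div_pos hx0 (prodConst_pos _ _ _)).ne'
    clear_value y
    have hf : fourierCoeff (layer p n).2 n = layerSeq p n * y := by
      have : layerSeq p n = fourierCoeff (layer p n).2 n / fourierCoeff (layer p n).1 0 := rfl
      rw [this, h2, div_mul_cancel₀ _ hy0]
    obtain ⟨k1, k2, k3⟩ := h1.mul_factor (fun j => -layerSeq p j)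
    have hys : star (y : ℂ) = y := Complex.conj_ofReal _
    have hn : normConst (-layerSeq p n) = normConst (layerSeq p n) := by simp [normConst]
    rw [← layer_succ] at k1 k2 k3
    rw [h2, hf] at k2 k3
    refine ⟨⟨k1.unit, k1.star_fst, ?_⟩, ?_⟩
    · push_cast
      refine k1.snd.succ ?_
      rw [k3, hys]
      ring
    · rw [k2, prodConst, Finset.prod_range_succ, ← prodConst, zero_add, ← div_div, ← hy, hn,
        Complex.ofReal_div]
      have hc : (normConst (layerSeq p n) : ℂ) ≠ 0 := by exact_mod_cast (normConst_pos _).ne'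
      rw [eq_div_iff hc]
      have := normConst_sq' (layerSeq p n)
      simp only [star_mul', hys]
      linear_combination (y : ℂ) * this

/-- This is `∏ (1 + |F_j|²) ≥ 1 + ∑ |F_j|²`. A positive lower bound for the constants therefore
makes `F` square summable. -/
theorem prodConst_sq_mul_le (F : ℤ → ℂ) (n : ℕ) :
    prodConst F 0 n ^ 2 * (1 + ∑ j ∈ Finset.range n, ‖F j‖ ^ 2) ≤ 1 := by
  induction n with
  | zero => simp [prodConst]
  | succ n ih =>
    have h1 := normConst_sq (F n)
    have h2 : prodConst F 0 (n + 1) = prodConst F 0 n * normConst (F n) := by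
      simp [prodConst, Finset.prod_range_succ]
    have hS : 0 ≤ ∑ j ∈ Finset.range n, ‖F j‖ ^ 2 := Finset.sum_nonneg fun _ _ => by positivity
    set S := ∑ j ∈ Finset.range n, ‖F j‖ ^ 2
    rw [Finset.sum_range_succ, h2]
    calc (prodConst F 0 n * normConst (F n)) ^ 2 * (1 + (S + ‖F n‖ ^ 2))
        ≤ (prodConst F 0 n * normConst (F n)) ^ 2 * ((1 + S) * (1 + ‖F n‖ ^ 2)) := by
          gcongr
          nlinarith [mul_nonneg hS (sq_nonneg ‖F n‖)]
      _ = prodConst F 0 n ^ 2 * (1 + S) * (normConst (F n) ^ 2 * (1 + ‖F n‖ ^ 2)) := by ring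
      _ ≤ 1 := by rw [h1, mul_one]; exact ih

theorem prodConst_antitone (F : ℤ → ℂ) : Antitone (prodConst F 0) := by
  refine antitone_nat_of_succ_le fun n => ?_
  rw [prodConst, Finset.prod_range_succ, ← prodConst]
  exact mul_le_of_le_one_right (prodConst_pos F 0 n).le (normConst_le_one _)

theorem sq_le_of_add_sq_eq {x y z : ℝ} (h : x ^ 2 + y ^ 2 = z) : x ≤ √z ∧ y ≤ √z :=
  ⟨Real.le_sqrt_of_sq_le (by nlinarith [sq_nonneg y]),
    Real.le_sqrt_of_sq_le (by nlinarith [sq_nonneg x])⟩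

theorem ae_norm_eq_one_of_tendsto {u v : ℕ → L2T} {f : L2T} (hu : Tendsto u atTop (𝓝 f))
    (hv : Tendsto v atTop (𝓝 0))
    (h : ∀ n, ∀ᵐ t ∂circMeas, u n t * star (u n t) + v n t * star (v n t) = 1) :
    ∀ᵐ t ∂circMeas, ‖f t‖ = 1 := by
  obtain ⟨ns, hns, h1⟩ := exists_seq_tendsto_ae hu
  obtain ⟨ms, hms, h2⟩ := exists_seq_tendsto_ae (hv.comp hns.tendsto_atTop)
  filter_upwards [h1, h2, ae_all_iff.mpr h, Lp.coeFn_zero ℂ 2 circMeas] with t e1 e2 e3 e4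
  have k1 := ((e1.comp hms.tendsto_atTop).norm.pow 2).add (e2.norm.pow 2)
  rw [e4] at k1
  have k2 : ∀ k, ‖u (ns (ms k)) t‖ ^ 2 + ‖v (ns (ms k)) t‖ ^ 2 = 1 := fun k =>
    mul_star_add_mul_star_eq_one_iff.mp (e3 _)
  have k3 := tendsto_nhds_unique k1 (tendsto_const_nhds.congr fun k => (k2 k).symm)
  simp only [Pi.zero_apply, norm_zero] at k3
  nlinarith [norm_nonneg (f t)]

/-! ### Right series -/

theorem tendsto_fourierCoeff_mul {q : Circ → ℂ} (hq : AEStronglyMeasurable q circMeas)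
    (hq1 : ∀ᵐ t ∂circMeas, ‖q t‖ ≤ 1) {u : ℕ → L2T} {f : L2T} (hu : Tendsto u atTop (𝓝 f))
    (k : ℤ) : Tendsto (fun n => fourierCoeff (fun t => q t * u n t) k) atTop
      (𝓝 (fourierCoeff (fun t => q t * f t) k)) := by
  have hm : ∀ v : L2T, MemLp (fun t => q t * v t) 2 circMeas := fun v =>
    memLp_bdd_mul hq hq1 (Lp.memLp v)
  have hlim : Tendsto (fun n => (hm (u n)).toLp _) atTop (𝓝 ((hm f).toLp _)) := by
    rw [tendsto_iff_norm_sub_tendsto_zero] at hu ⊢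
    refine squeeze_zero (fun _ => norm_nonneg _) (fun n => ?_) hu
    rw [← one_mul ‖u n - f‖]
    refine norm_le_mul_of_ae (Lp.coeFn_sub _ _) (Lp.coeFn_sub _ _) ?_
    filter_upwards [(hm (u n)).coeFn_toLp, (hm f).coeFn_toLp, hq1] with t e1 e2 e3
    rw [Pi.sub_apply, Pi.sub_apply, e1, e2, ← mul_sub, norm_mul]
    gcongr
  have h := ((continuous_fourierCoeff k).tendsto _).comp hlim
  rw [fourierCoeff_congr_ae (hm f).coeFn_toLp] at h
  refine h.congr fun n => ?_
  exact congrFun (fourierCoeff_congr_ae (hm (u n)).coeFn_toLp) k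

/-- Intended for `G_{0,n} = p L_n⁻¹` with layers `L_n → (s, 0)`: the terms containing the second
component of `L_n` disappear in the limit. -/
theorem vanishBelow_mul_of_tendsto {q r : Circ → ℂ} (hq : AEStronglyMeasurable q circMeas)
    (hq1 : ∀ᵐ t ∂circMeas, ‖q t‖ ≤ 1) (hr : AEStronglyMeasurable r circMeas)
    (hr1 : ∀ᵐ t ∂circMeas, ‖r t‖ ≤ 1) {u v : ℕ → L2T} {f : L2T} (hu : Tendsto u atTop (𝓝 f))
    (hv : Tendsto v atTop (𝓝 0)) {m : ℤ}
    (h : ∀ n, VanishBelow m (fun t => q t * u n t + r t * v n t)) :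
    VanishBelow m (fun t => q t * f t) := by
  refine ⟨memLp_bdd_mul hq hq1 (Lp.memLp f), fun k hk => ?_⟩
  have h1 := (tendsto_fourierCoeff_mul hq hq1 hu k).add (tendsto_fourierCoeff_mul hr hr1 hv k)
  have h0 : fourierCoeff (fun t => r t * (0 : L2T) t) k = 0 := by
    have : (fun t => r t * (0 : L2T) t) =ᵐ[circMeas] fun _ => (0 : ℂ) := by
      filter_upwards [Lp.coeFn_zero ℂ 2 circMeas] with t e
      rw [e, Pi.zero_apply, mul_zero]
    rw [fourierCoeff_congr_ae this, fourierCoeff_const, ite_self]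
  rw [h0, add_zero] at h1
  refine tendsto_nhds_unique h1 (tendsto_const_nhds.congr fun n => ?_)
  rw [← fourierCoeff_add (memLp_bdd_mul hq hq1 (Lp.memLp _)) (memLp_bdd_mul hr hr1 (Lp.memLp _)),
    (h n).2 k hk]

theorem vanishBelow_star_of_tendsto {m : ℤ} {u : ℕ → L2T} {f : L2T} (hu : Tendsto u atTop (𝓝 f))
    (h : ∀ n, VanishBelow m (fun t => star (u n t))) : VanishBelow m (fun t => star (f t)) := by
  refine VanishBelow.star_of_forall (Lp.memLp f) fun k hk => ?_
  refine tendsto_nhds_unique (((continuous_fourierCoeff k).tendsto f).comp hu)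
    (tendsto_const_nhds.congr fun n => ?_)
  exact ((h n).fourierCoeff_eq_zero_of_star hk).symm

theorem isLayer_of_mem {p : FunPair} (hp : p ∈ spaceL) {m : ℤ} (h : VanishBelow m p.2) :
    IsLayer m ((p.1 : Circ → ℂ), (p.2 : Circ → ℂ)) := by
  rw [mem_spaceL_iff] at hp
  exact ⟨hp.1, hp.2.1, h⟩

theorem toFunPair_eq_toL {p : C(Circ, ℂ) × C(Circ, ℂ)} {m : ℤ} (h : IsLayer m (coePair p)) :
    toFunPair p = h.toL := by
  refine Prod.ext (Lp.ext ?_) (Lp.ext ?_)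
  · exact (ContinuousMap.coeFn_toLp (p := 2) (𝕜 := ℂ) circMeas p.1).trans h.coeFn_fst.symm
  · exact (ContinuousMap.coeFn_toLp (p := 2) (𝕜 := ℂ) circMeas p.2).trans h.coeFn_snd.symm

theorem valInfty_toFunPair (F : ℤ → ℂ) (M : ℤ) (n : ℕ) :
    valInfty (toFunPair (partialProd F M n)).1 = prodConst F M n := by
  rw [valInfty_eq, ← (isLayer_partialProd F M n).2]
  exact fourierCoeff_toLp _ _

/-- The values at infinity of the layers of a pair in `𝐇` tend to one, since the limit of the
layers would give a common inner factor. -/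
theorem tendsto_layer_value {p : (Circ → ℂ) × (Circ → ℂ)} {x : ℝ} (hp : IsLayer 0 p)
    (hx : fourierCoeff p.1 0 = x) (hx0 : 0 < x)
    (hinner : NoCommonInnerFactor (fun t => star (p.1 t)) p.2) :
    Tendsto (fun n => x / prodConst (layerSeq p) 0 n) atTop (𝓝 1) := by
  set F := layerSeq p with hF
  set y : ℕ → ℝ := fun n => x / prodConst F 0 n with hy
  have hlay : ∀ n : ℕ, IsLayer n (layer p n) ∧ fourierCoeff (layer p n).1 0 = (y n : ℂ) :=
    isLayer_layer hp hx hx0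
  have hP := prodConst_pos F 0
  have hy1 : ∀ n, y n ≤ 1 := fun n => by
    have := (hlay n).1.re_le_one
    rwa [(hlay n).2, Complex.ofReal_re] at this
  have hmono : Monotone y := fun m n h => by
    have := prodConst_antitone F h
    have := hP n
    simp only [hy]
    gcongr
  have hxy : ∀ n, x ≤ y n := fun n => by
    have := hmono (Nat.zero_le n)
    simpa [hy, prodConst] using this
  obtain ⟨z, hz⟩ : ∃ z, Tendsto y atTop (𝓝 z) :=
    ⟨_, tendsto_atTop_ciSup hmono ⟨1, by rintro _ ⟨n, rfl⟩; exact hy1 n⟩⟩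
  have hyz : ∀ n, y n ≤ z := hmono.ge_of_tendsto hz
  have hz0 : 0 < z := hx0.trans_le ((hxy 0).trans (hyz 0))
  let L : ℕ → FunPair := fun n => (hlay n).1.toL
  -- Layer `m` is a partial product times layer `m + k`, and that product has value `y m / y (m +
  -- k)` at infinity. Convergence of `y` thus makes the layers Cauchy.
  have hdist : ∀ m n, m ≤ n → ‖(L m).1 - (L n).1‖ ^ 2 + ‖(L m).2 - (L n).2‖ ^ 2 ≤
      2 / x * (z - y m) := fun m n hmn => by
    obtain ⟨k, rfl⟩ := Nat.exists_eq_add_of_le hmn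
    have h1 := (isLayer_partialProd F m k).1.norm_sub_right (hlay (m + k)).1 (hlay m).1
      (layer_eq_mulSU2 p m k)
    have h2 : fourierCoeff (coePair (partialProd F m k)).1 0 = prodConst F m k :=
      (isLayer_partialProd F m k).2
    refine h1.trans_le ?_
    rw [h2, Complex.ofReal_re]
    have h3 : prodConst F m k = y m / y (m + k) := by
      have := prodConst_add F 0 m k
      rw [zero_add] at this
      simp only [hy]
      rw [this]
      have := (hP m).ne'
      have := (prodConst_pos F m k).ne'
      field_simp
    have hyk : 0 < y (m + k) := hx0.trans_le (hxy _)
    have h4 : 2 - 2 * (y m / y (m + k)) = 2 / y (m + k) * (y (m + k) - y m) := by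
      field_simp
    rw [h3, h4]
    have := hxy (m + k)
    have := hyz (m + k)
    have := hmono hmn
    gcongr
  have hb : Tendsto (fun n => √(2 / x * (z - y n))) atTop (𝓝 0) := by
    have := ((hz.const_sub z).const_mul (2 / x)).sqrt
    simpa using this
  have hc1 : CauchySeq fun n => (L n).1 := cauchySeq_of_le_tendsto_0' _ (fun m n hmn => by
    rw [dist_eq_norm]
    exact Real.le_sqrt_of_sq_le ((le_add_of_nonneg_right (sq_nonneg _)).trans (hdist m n hmn))) hb
  have hc2 : CauchySeq fun n => (L n).2 := cauchySeq_of_le_tendsto_0' _ (fun m n hmn => by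
    rw [dist_eq_norm]
    exact Real.le_sqrt_of_sq_le ((le_add_of_nonneg_left (sq_nonneg _)).trans (hdist m n hmn))) hb
  obtain ⟨s, hs⟩ := cauchySeq_tendsto_of_complete hc1
  obtain ⟨s', hs'⟩ := cauchySeq_tendsto_of_complete hc2
  have hsnd : ∀ n : ℕ, VanishBelow n (L n).2 := fun n =>
    (hlay n).1.snd.congr (hlay n).1.coeFn_snd.symm
  have hfst : ∀ n : ℕ, VanishBelow 0 (fun t => star ((L n).1 t)) := fun n =>
    (hlay n).1.star_fst.congr (by
      filter_upwards [(hlay n).1.coeFn_fst] with t e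
      rw [← e])
  -- The support of the second components moves off to infinity.
  have hs'0 : s' = 0 := by
    refine ext_fourierCoeff fun k => ?_
    have h1 : VanishBelow (k + 1) s' := by
      refine vanishBelow_of_tendsto ?_ hs'
      filter_upwards [eventually_ge_atTop (k + 1).toNat] with n hn
      exact (hsnd n).mono (by omega)
    rw [h1.2 k (by omega), fourierCoeff_congr_ae (Lp.coeFn_zero ℂ 2 circMeas)]
    exact ((fourierCoeff_const 0 k).trans (ite_self _)).symm
  rw [hs'0] at hs'
  have hunit : ∀ n, ∀ᵐ t ∂circMeas,
      (L n).1 t * star ((L n).1 t) + (L n).2 t * star ((L n).2 t) = 1 := fun n => by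
    filter_upwards [(hlay n).1.unit, (hlay n).1.coeFn_fst, (hlay n).1.coeFn_snd] with t e e1 e2
    rwa [e1, e2]
  have hs1 := ae_norm_eq_one_of_tendsto hs hs' hunit
  have hsinv : ∀ᵐ t ∂circMeas, (star (s t))⁻¹ = s t := by
    filter_upwards [hs1] with t ht
    rw [Complex.inv_def, Complex.normSq_eq_norm_sq, norm_star, ht]
    simp
  have hrec : ∀ n, ∀ᵐ t ∂circMeas,
      (partialProd F 0 n).1 t = p.1 t * star ((L n).1 t) + p.2 t * star ((L n).2 t) ∧
      (partialProd F 0 n).2 t = p.2 t * (L n).1 t + -p.1 t * (L n).2 t := fun n => by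
    filter_upwards [(hlay n).1.unit, (hlay n).1.coeFn_fst, (hlay n).1.coeFn_snd] with t e e1 e2
    have h1 := layer_eq_mulSU2 p 0 n
    rw [zero_add] at h1
    have h2 : p.1 t = (partialProd F 0 n).1 t * (layer p n).1 t -
      (partialProd F 0 n).2 t * star ((layer p n).2 t) := congrFun (congrArg Prod.fst h1) t
    have h3 : p.2 t = (partialProd F 0 n).1 t * (layer p n).2 t +
      (partialProd F 0 n).2 t * star ((layer p n).1 t) := congrFun (congrArg Prod.snd h1) t
    rw [e1, e2, h2, h3]
    constructor
    · linear_combination -(partialProd F 0 n).1 t * e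
    · linear_combination -(partialProd F 0 n).2 t * e
  have hp1 : ∀ᵐ t ∂circMeas, ‖p.1 t‖ ≤ 1 ∧ ‖p.2 t‖ ≤ 1 := by
    filter_upwards [hp.unit] with t ht
    exact norm_le_one_of_unit ht
  have hm1 : AEStronglyMeasurable p.1 circMeas := hp.memLp_fst.1
  have hm2 : AEStronglyMeasurable p.2 circMeas := hp.snd.1.1
  have hG := fun n => (isLayer_partialProd F 0 n).1
  -- `a^* s` and `b s` are limits of the analytic functions coming from `G_{0,n}`. As `s = (s^*)⁻¹`,
  -- this says that the inner function `s^*` divides both `a^*` and `b`.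
  have hu : VanishBelow 0 (fun t => star (p.1 t) * s t) := by
    refine vanishBelow_mul_of_tendsto (q := fun t => star (p.1 t))
      (r := fun t => star (p.2 t)) hm1.star ?_ hm2.star ?_ hs hs'
      fun n => (hG n).star_fst.congr ?_
    · filter_upwards [hp1] with t e
      rw [norm_star]
      exact e.1
    · filter_upwards [hp1] with t e
      rw [norm_star]
      exact e.2
    · filter_upwards [hrec n] with t e
      change star ((partialProd F 0 n).1 t) = _
      rw [e.1]
      simp only [star_add, star_mul', star_star]
  have hv : VanishBelow 0 (fun t => p.2 t * s t) := by
    refine vanishBelow_mul_of_tendsto (r := fun t => -p.1 t) hm2 (hp1.mono fun t e => e.2) hm1.neg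
      ?_ hs hs' fun n => (hG n).snd.congr ?_
    · filter_upwards [hp1] with t e
      rw [norm_neg]
      exact e.1
    · filter_upwards [hrec n] with t e
      exact e.2
  have hstar := vanishBelow_star_of_tendsto hs hfst
  obtain ⟨c, hc⟩ := hinner (fun t => star (s t))
    ⟨hstar, hs1.mono fun t e => by rw [norm_star, e]⟩
    (hu.congr (hsinv.mono fun t e => by dsimp only; rw [e]))
    (hv.congr (hsinv.mono fun t e => by dsimp only; rw [e]))
  -- The unimodular constant `s` has mean `z > 0`, which forces `z = 1`.
  have hval : fourierCoeff s 0 = z := by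
    refine tendsto_nhds_unique (((continuous_fourierCoeff 0).tendsto s).comp hs)
      (((Complex.continuous_ofReal.tendsto z).comp hz).congr fun n => ?_)
    exact ((congrFun (fourierCoeff_congr_ae (hlay n).1.coeFn_fst) 0).trans (hlay n).2).symm
  have hsc : s =ᵐ[circMeas] fun _ => star c := by
    filter_upwards [hc] with t e
    rw [← e, star_star]
  rw [fourierCoeff_congr_ae hsc, fourierCoeff_const, if_pos rfl] at hval
  obtain ⟨t, e1, e2⟩ := (hs1.and hsc).exists
  rw [e2, hval, Complex.norm_real, Real.norm_of_nonneg hz0.le] at e1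
  rwa [e1] at hz

/-- The layers have value at most `1` at infinity, so the constants of the partial products stay
above `a(∞) > 0` and `F` is square summable. The squared `L²` distance from the `n`-th partial
product to `p` is `2 - 2 y_n`, with `y_n` the value at infinity of the `n`-th layer, and `y_n → 1`.
-/
theorem exists_isRightSeries {p : FunPair} (hp : p ∈ spaceH) :
    ∃ F : ℤ → ℂ, (Summable fun n : ℕ => ‖F n‖ ^ 2) ∧ IsRightSeries F p := by
  obtain ⟨hL, hb, hinner⟩ := mem_spaceH_iff.mp hp
  set p' : (Circ → ℂ) × (Circ → ℂ) := ((p.1 : Circ → ℂ), (p.2 : Circ → ℂ)) with hp'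
  have hlay : IsLayer 0 p' := isLayer_of_mem hL hb
  obtain ⟨-, -, him, hre⟩ := mem_spaceL_iff.mp hL
  set x := (fourierCoeff p.1 0).re with hx
  have hxe : fourierCoeff p'.1 0 = x := Complex.ext rfl (by simpa using him)
  have hlays := isLayer_layer hlay hxe hre
  have hlim := tendsto_layer_value hlay hxe hre hinner
  set F := layerSeq p'
  have hP := prodConst_pos F 0
  have hle : ∀ n, x ≤ prodConst F 0 n := fun n => by
    have := (hlays n).1.re_le_one
    rwa [(hlays n).2, Complex.ofReal_re, div_le_one (hP n)] at this
  refine ⟨F, summable_of_sum_range_le (c := 1 / x ^ 2) (fun n => sq_nonneg _) fun n => ?_, hL, ?_⟩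
  · have h1 := prodConst_sq_mul_le F n
    have h2 : x ^ 2 ≤ prodConst F 0 n ^ 2 := by
      have := hle n
      gcongr
    have hS : 0 ≤ ∑ j ∈ Finset.range n, ‖F j‖ ^ 2 := Finset.sum_nonneg fun _ _ => by positivity
    rw [le_div_iff₀ (by positivity)]
    nlinarith [mul_le_mul_of_nonneg_left h2 hS, sq_nonneg (prodConst F 0 n)]
  · have hG := fun n => (isLayer_partialProd F 0 n).1
    have heq : hlay.toL = p := Prod.ext (Lp.toLp_coeFn p.1 (Lp.memLp _))
      (Lp.toLp_coeFn p.2 (Lp.memLp _))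
    have hd : ∀ n, ‖p.1 - (toFunPair (partialProd F 0 n)).1‖ ^ 2 +
        ‖p.2 - (toFunPair (partialProd F 0 n)).2‖ ^ 2 = 2 - 2 * (x / prodConst F 0 n) := fun n => by
      have h1 := layer_eq_mulSU2 p' 0 n
      rw [zero_add] at h1
      have := (hG n).norm_sub_left (hlays n).1 hlay h1
      rwa [heq, (hlays n).2, Complex.ofReal_re, ← toFunPair_eq_toL (hG n)] at this
    have hsq : Tendsto (fun n => √(2 - 2 * (x / prodConst F 0 n))) atTop (𝓝 0) := by
      have := ((hlim.const_mul 2).const_sub 2).sqrt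
      simpa using this
    have hPlim : Tendsto (prodConst F 0) atTop (𝓝 x) := by
      have := (tendsto_const_nhds (x := x)).div hlim one_ne_zero
      rw [div_one] at this
      refine this.congr fun n => ?_
      simp only [Pi.div_apply]
      have := (hP n).ne'
      field_simp
    have hlog : Tendsto (fun n => |Real.log (prodConst F 0 n) - Real.log x|) atTop (𝓝 0) := by
      have := (((Real.continuousAt_log hre.ne').tendsto.comp hPlim).sub_const (Real.log x)).abs
      simpa using this
    refine squeeze_zero (fun n => by unfold rho; positivity) (fun n => ?_)
      (by simpa using (hsq.add hsq).add hlog)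
    rw [rho, valInfty_toFunPair, valInfty_eq, Complex.ofReal_re]
    obtain ⟨h1, h2⟩ := sq_le_of_add_sq_eq (hd n)
    rw [norm_sub_rev] at h1 h2
    gcongr

/-! ### Uniqueness of the coefficients -/

theorem tendsto_of_rho {u : ℕ → FunPair} {p : FunPair}
    (h : Tendsto (fun n => rho (u n) p) atTop (𝓝 0)) :
    Tendsto (fun n => (u n).1) atTop (𝓝 p.1) ∧ Tendsto (fun n => (u n).2) atTop (𝓝 p.2) := by
  constructor <;> rw [tendsto_iff_norm_sub_tendsto_zero] <;>
    refine squeeze_zero (fun n => norm_nonneg _) (fun n => ?_) h <;> unfold rho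
  · have := norm_nonneg ((u n).2 - p.2)
    have := abs_nonneg (Real.log (valInfty (u n).1).re - Real.log (valInfty p.1).re)
    linarith
  · have := norm_nonneg ((u n).1 - p.1)
    have := abs_nonneg (Real.log (valInfty (u n).1).re - Real.log (valInfty p.1).re)
    linarith

theorem tendsto_star {u : ℕ → L2T} {f : L2T} (h : Tendsto u atTop (𝓝 f)) :
    Tendsto (fun n => star (u n)) atTop (𝓝 (star f)) := by
  rw [tendsto_iff_norm_sub_tendsto_zero] at h ⊢
  simpa only [norm_star_sub_star] using h

namespace IsRightSeries

variable {F : ℤ → ℂ} {p : FunPair}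

theorem vanishBelow_snd (h : IsRightSeries F p) : VanishBelow 0 p.2 := by
  refine vanishBelow_of_tendsto (Eventually.of_forall fun n => ?_) (tendsto_of_rho h.2).2
  exact (isLayer_partialProd F 0 n).1.snd.congr
    (ContinuousMap.coeFn_toLp (p := 2) (𝕜 := ℂ) circMeas _).symm

theorem congr (h : IsRightSeries F p) {F' : ℤ → ℂ} (hF : ∀ k, 0 ≤ k → F k = F' k) :
    IsRightSeries F' p := by
  refine ⟨h.1, h.2.congr fun n => ?_⟩
  rw [partialProd_congr fun k hk _ => hF k hk]

/-- The coefficient `F M` is determined by the series and the coefficients before it. -/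
theorem coeff_eq (h : IsRightSeries F p) (M : ℕ) :
    let g := partialProd F 0 M
    let α := fourierCoeff (fun t => star (g.1 t) * p.1 t) 0 +
      fourierCoeff (fun t => g.2 t * (star p.2 : L2T) t) 0
    α ≠ 0 ∧ fourierCoeff (fun t => star (g.1 t) * p.2 t) M +
      fourierCoeff (fun t => -g.2 t * (star p.1 : L2T) t) M = F M * α := by
  intro g α
  obtain ⟨h1, h2⟩ := tendsto_of_rho h.2
  -- The shift by `M + 1` ensures that every partial product considered contains the factor of index
  -- `M`.
  have h1' := h1.comp (tendsto_add_atTop_nat (M + 1))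
  have h2' := h2.comp (tendsto_add_atTop_nat (M + 1))
  have hg : ∀ t, ‖g.1 t‖ ≤ 1 ∧ ‖g.2 t‖ ≤ 1 := fun t =>
    norm_le_one_of_unit (congrFun (detSU2_coePair g (detSU2_partialProd F 0 M)) t)
  have m1 : AEStronglyMeasurable (fun t => star (g.1 t)) circMeas :=
    (map_continuous g.1).aestronglyMeasurable.star
  have m2 : AEStronglyMeasurable g.2 circMeas := (map_continuous g.2).aestronglyMeasurable
  have m2' : AEStronglyMeasurable (fun t => -g.2 t) circMeas := m2.neg
  have b1 : ∀ᵐ t ∂circMeas, ‖star (g.1 t)‖ ≤ 1 := ae_of_all _ fun t => by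
    rw [norm_star]; exact (hg t).1
  have b2 : ∀ᵐ t ∂circMeas, ‖g.2 t‖ ≤ 1 := ae_of_all _ fun t => (hg t).2
  have b2' : ∀ᵐ t ∂circMeas, ‖-g.2 t‖ ≤ 1 := ae_of_all _ fun t => by
    rw [norm_neg]; exact (hg t).2
  have hα := (tendsto_fourierCoeff_mul m1 b1 h1' 0).add
    (tendsto_fourierCoeff_mul m2 b2 (tendsto_star h2') 0)
  have hβ := (tendsto_fourierCoeff_mul m1 b1 h2' M).add
    (tendsto_fourierCoeff_mul m2' b2' (tendsto_star h1') M)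
  -- Removing the first `M` factors leaves a product starting at `M`, whose leading coefficients
  -- have ratio `F M`. Its entries depend continuously on the full product, so the ratio survives in
  -- the limit.
  have htail : ∀ n, partialProd F M (n + 1) =
      mulSU2 (invSU2 g) (partialProd F 0 (n + (M + 1))) := fun n => by
    rw [show n + (M + 1) = M + (n + 1) by ring, partialProd_add F 0 M, ← mulSU2_assoc,
      invSU2_mulSU2 (detSU2_partialProd F 0 M), one_mulSU2, zero_add]
  have c1 : ∀ n, (toFunPair (partialProd F 0 n)).1 =ᵐ[circMeas] (partialProd F 0 n).1 := fun n =>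
    ContinuousMap.coeFn_toLp (p := 2) (𝕜 := ℂ) circMeas _
  have c2 : ∀ n, (toFunPair (partialProd F 0 n)).2 =ᵐ[circMeas] (partialProd F 0 n).2 := fun n =>
    ContinuousMap.coeFn_toLp (p := 2) (𝕜 := ℂ) circMeas _
  have k1 : ∀ n, fourierCoeff (fun t => star (g.1 t) * (toFunPair
      (partialProd F 0 (n + (M + 1)))).1 t) 0 + fourierCoeff (fun t => g.2 t *
        (star (toFunPair (partialProd F 0 (n + (M + 1)))).2 : L2T) t) 0 =
      prodConst F M (n + 1) := fun n => by
    rw [← (isLayer_partialProd F M (n + 1)).2, htail,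
      ← fourierCoeff_add (memLp_bdd_mul m1 b1 (Lp.memLp _)) (memLp_bdd_mul m2 b2 (Lp.memLp _))]
    refine congrFun (fourierCoeff_congr_ae ?_) 0
    filter_upwards [c1 (n + (M + 1)), c2 (n + (M + 1)),
      Lp.coeFn_star (toFunPair (partialProd F 0 (n + (M + 1)))).2] with t e1 e2 e3
    rw [e1, e3, Pi.star_apply, e2]
    change _ = star (g.1 t) * _ - -g.2 t * star _
    ring
  have k2 : ∀ n, fourierCoeff (fun t => star (g.1 t) * (toFunPair
      (partialProd F 0 (n + (M + 1)))).2 t) M + fourierCoeff (fun t => -g.2 t *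
        (star (toFunPair (partialProd F 0 (n + (M + 1)))).1 : L2T) t) M =
      F M * prodConst F M (n + 1) := fun n => by
    rw [← fourierCoeff_partialProd_snd F M n, htail,
      ← fourierCoeff_add (memLp_bdd_mul m1 b1 (Lp.memLp _)) (memLp_bdd_mul m2' b2' (Lp.memLp _))]
    refine congrFun (fourierCoeff_congr_ae ?_) M
    filter_upwards [c1 (n + (M + 1)), c2 (n + (M + 1)),
      Lp.coeFn_star (toFunPair (partialProd F 0 (n + (M + 1)))).1] with t e1 e2 e3
    rw [e2, e3, Pi.star_apply, e1]
    rfl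
  have hα' : Tendsto (fun n => (prodConst F M (n + 1) : ℂ)) atTop (𝓝 α) := hα.congr k1
  -- `α` is the limit of the tail values at infinity, and it is nonzero because `a(∞) > 0` is a
  -- multiple of it.
  have hx : fourierCoeff p.1 0 = prodConst F 0 M * α := by
    refine tendsto_nhds_unique (((continuous_fourierCoeff 0).tendsto _).comp h1')
      ((hα'.const_mul _).congr fun n => ?_)
    have e := prodConst_add F 0 M (n + 1)
    rw [zero_add] at e
    rw [← Complex.ofReal_mul, ← e, show M + (n + 1) = n + (M + 1) by ring,
      ← (isLayer_partialProd F 0 _).2]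
    exact (fourierCoeff_toLp _ _).symm
  refine ⟨fun h0 => ?_, ?_⟩
  · have := (mem_spaceL_iff.mp h.1).2.2.2
    rw [hx, h0, mul_zero] at this
    simp at this
  · exact tendsto_nhds_unique hβ ((hα'.const_mul (F M)).congr fun n => (k2 n).symm)

theorem unique (h : IsRightSeries F p) {F' : ℤ → ℂ} (h' : IsRightSeries F' p) (M : ℕ) :
    F M = F' M := by
  induction M using Nat.strong_induction_on with
  | _ M ih =>
    have hg : partialProd F 0 M = partialProd F' 0 M := partialProd_congr fun k hk hk' => by
      obtain ⟨n, rfl⟩ := Int.eq_ofNat_of_zero_le hk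
      exact ih n (by omega)
    obtain ⟨h0, h1⟩ := h.coeff_eq M
    obtain ⟨-, h2⟩ := h'.coeff_eq M
    rw [← hg] at h2
    exact mul_right_cancel₀ h0 (h1.symm.trans h2)

theorem coeff_zero (h : IsRightSeries F p) (h0 : VanishBelow 1 p.2) : F 0 = 0 := by
  obtain ⟨k0, k1⟩ := h.coeff_eq 0
  have e1 : fourierCoeff (fun t => star ((partialProd F 0 0).1 t) * p.2 t) ((0 : ℕ) : ℤ) = 0 := by
    have : (fun t => star ((partialProd F 0 0).1 t) * p.2 t) = p.2 := by
      funext t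
      simp [partialProd]
    rw [this]
    exact h0.2 0 (by omega)
  have e2 : fourierCoeff (fun t => -(partialProd F 0 0).2 t * (star p.1 : L2T) t)
      ((0 : ℕ) : ℤ) = 0 := by
    have : (fun t => -(partialProd F 0 0).2 t * (star p.1 : L2T) t) = fun _ => 0 := by
      funext t
      simp [partialProd]
    rw [this, fourierCoeff_const, ite_self]
  rw [e1, e2, add_zero, eq_comm, mul_eq_zero] at k1
  exact k1.resolve_right k0

end IsRightSeries

/-! ### Left series -/

/-- The sequence on `[1, ∞)` obtained from the part of `F` on `(-∞, -1]` by reflection. -/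
noncomputable def reflectSeq (F : ℤ → ℂ) (k : ℤ) : ℂ := if 1 ≤ k then star (F (-k)) else 0

theorem flipSU2_factor (F : ℤ → ℂ) {k : ℤ} (hk : 1 ≤ k) :
    flipSU2 (factor F (-k)) = factor (reflectSeq F) k := by
  have e : reflectSeq F k = star (F (-k)) := if_pos hk
  have hn : normConst (star (F (-k))) = normConst (F (-k)) := by
    unfold normConst
    rw [norm_star]
  refine Prod.ext (ContinuousMap.ext fun t => ?_) (ContinuousMap.ext fun t => ?_)
  · change (factor F (-k)).1 t = _
    rw [factor_fst_apply, factor_fst_apply, e, hn]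
  · change star ((factor F (-k)).2 t) = _
    have hc : star (normConst (F (-k)) : ℂ) = normConst (F (-k)) := Complex.conj_ofReal _
    rw [factor_snd_apply, factor_snd_apply, e, hn, star_mul', star_mul', hc, star_fourier, neg_neg]

/-- The flip reverses the order of the factors and turns `z^{-k}` into `z^k`. The length grows by
one because the reflected sequence also has the trivial factor of index `0`. -/
theorem flipSU2_partialProd (F : ℤ → ℂ) (n : ℕ) :
    flipSU2 (partialProd F (-(n : ℤ)) n) = partialProd (reflectSeq F) 0 (n + 1) := by
  induction n with
  | zero =>
    have : reflectSeq F 0 = 0 := if_neg (by omega)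
    refine Prod.ext (ContinuousMap.ext fun t => ?_) (ContinuousMap.ext fun t => ?_) <;>
      simp [partialProd, one_mulSU2, flipSU2, factor, this]
  | succ n ih =>
    rw [partialProd_succ', flipSU2_mulSU2, partialProd, ← ih]
    congr 2
    · push_cast
      ring_nf
    · rw [flipSU2_factor F (by omega)]
      push_cast
      ring_nf

theorem flip_mem_spaceL {p : FunPair} (hp : p ∈ spaceL) : (p.1, star p.2) ∈ spaceL := by
  rw [mem_spaceL_iff] at hp ⊢
  refine ⟨?_, hp.2⟩
  filter_upwards [hp.1, Lp.coeFn_star p.2] with t e1 e2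
  rw [e2, Pi.star_apply, star_star, mul_comm (star _)]
  exact e1

theorem toFunPair_flipSU2 (p : C(Circ, ℂ) × C(Circ, ℂ)) :
    toFunPair (flipSU2 p) = ((toFunPair p).1, star (toFunPair p).2) := by
  refine Prod.ext rfl (Lp.ext ?_)
  filter_upwards [ContinuousMap.coeFn_toLp (p := 2) (𝕜 := ℂ) circMeas p.2,
    ContinuousMap.coeFn_toLp (p := 2) (𝕜 := ℂ) circMeas (star p.2),
    Lp.coeFn_star (toFunPair p).2] with t e1 e2 e3
  rw [e3, Pi.star_apply]
  exact e2.trans (congrArg star e1.symm)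

/-- The flip preserves `rho`, and the index shift by one does not affect the limit. -/
theorem isLeftSeries_iff {F : ℤ → ℂ} {p : FunPair} :
    IsLeftSeries F p ↔ IsRightSeries (reflectSeq F) (p.1, star p.2) := by
  have hL : p ∈ spaceL ↔ (p.1, star p.2) ∈ spaceL :=
    ⟨flip_mem_spaceL, fun h => by simpa using flip_mem_spaceL h⟩
  refine and_congr hL ?_
  rw [← tendsto_add_atTop_iff_nat
    (f := fun n => rho (toFunPair (partialProd (reflectSeq F) 0 n)) (p.1, star p.2)) 1]
  have : ∀ n : ℕ, rho (toFunPair (partialProd (reflectSeq F) 0 (n + 1))) (p.1, star p.2) =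
      rho (toFunPair (partialProd F (-(n : ℤ)) n)) p := fun n => by
    rw [← flipSU2_partialProd, toFunPair_flipSU2]
    simp only [rho, norm_star_sub_star]
  simp only [this]

theorem IsLeftSeries.vanishBelow_snd {F : ℤ → ℂ} {p : FunPair} (h : IsLeftSeries F p) :
    VanishBelow 1 (fun t => star (p.2 t)) := by
  have h1 := isLeftSeries_iff.mp h
  have h2 : VanishBelow 0 (star p.2 : L2T) := h1.vanishBelow_snd
  refine VanishBelow.congr (h2.succ ?_) (Lp.coeFn_star p.2)
  refine tendsto_nhds_unique (((continuous_fourierCoeff 0).tendsto _).comp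
    ((tendsto_of_rho h1.2).2.comp (tendsto_add_atTop_nat 1)))
    (tendsto_const_nhds.congr fun n => ?_)
  refine Eq.symm ((fourierCoeff_toLp _ _).trans ?_)
  have := fourierCoeff_partialProd_snd (reflectSeq F) 0 n
  rw [this, reflectSeq, if_neg (by omega), zero_mul]

/-! ### Nonlinear Fourier series of factorizations -/

/-- The factors of a nonlinear Fourier series form a factorization. -/
theorem isFactorization_of_series {F : ℤ → ℂ} {a b : L2T} {pm pp : FunPair}
    (hm : IsLeftSeries F pm) (hp : IsRightSeries F pp) (h : IsProd pm pp (a, b)) :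
    IsFactorization a b pm.1 pm.2 pp.1 pp.2 :=
  isFactorization_of_mem hm.1 hm.vanishBelow_snd hp.1 hp.vanishBelow_snd h

theorem IsLeftSeries.unique {F F' : ℤ → ℂ} {p : FunPair} (h : IsLeftSeries F p)
    (h' : IsLeftSeries F' p) {k : ℤ} (hk : k < 0) : F k = F' k := by
  obtain ⟨n, hn⟩ := Int.eq_ofNat_of_zero_le (show 0 ≤ -k by omega)
  have := (isLeftSeries_iff.mp h).unique (isLeftSeries_iff.mp h') n
  rw [← Int.ofNat_eq_natCast, Int.ofNat_eq_natCast, ← hn, reflectSeq, reflectSeq,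
    if_pos (by omega), if_pos (by omega), neg_neg] at this
  exact star_injective this

theorem exists_isNonlinearFourierSeries {a b am bm ap bp : L2T} (hm : (am, bm) ∈ spaceH0Star)
    (hp : (ap, bp) ∈ spaceH) (h : IsProd (am, bm) (ap, bp) (a, b)) :
    ∃ F : lp (fun _ : ℤ => ℂ) 2, IsNonlinearFourierSeries F (a, b) := by
  obtain ⟨Fp, hs, hFp⟩ := exists_isRightSeries hp
  obtain ⟨Fm, hs', hFm⟩ := exists_isRightSeries hm.2.1
  -- This is where `b_-^*(0) = 0` enters: the reflected sequence has no term of index `0`, so that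
  -- index is left to the right factor.
  have hzero : Fm 0 = 0 := hFm.coeff_zero
    ((mem_spaceH0Star_iff.mp hm).2.1.congr (Lp.coeFn_star bm).symm)
  let G : ℤ → ℂ := fun k => if 0 ≤ k then Fp k else star (Fm (-k))
  have hG1 : IsRightSeries G (ap, bp) := hFp.congr fun k hk => (if_pos hk).symm
  have hG2 : IsLeftSeries G (am, bm) := by
    refine isLeftSeries_iff.mpr (hFm.congr fun k hk => ?_)
    rcases hk.eq_or_lt with rfl | hk
    · rw [hzero, reflectSeq, if_neg (by omega)]
    · rw [reflectSeq, if_pos (by omega)]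
      simp only [G]
      rw [if_neg (by omega), star_star, neg_neg]
  have hsum : Summable fun k : ℤ => ‖G k‖ ^ 2 := by
    refine Summable.of_nat_of_neg_add_one ?_ ?_
    · refine hs.congr fun n => ?_
      simp [G]
    · refine ((summable_nat_add_iff 1).mpr hs').congr fun n => ?_
      simp only [G]
      rw [if_neg (by omega), norm_star, neg_neg]
      push_cast
      rfl
  have hmem : Memℓp G 2 := by
    refine memℓp_gen ?_
    simpa using hsum
  exact ⟨⟨G, hmem⟩, (am, bm), (ap, bp), hG2, hG1, h⟩

end NLFS

open NLFS
theorem mainTheorem2 (a b : L2T) (hab : (a, b) ∈ spaceB) :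
    -- existence and uniqueness of the factorization `(a_-, b_-)(a_+, b_+) = (a, b)`
    (∃! q : FunPair × FunPair,
      q.1 ∈ spaceH0Star ∧ q.2 ∈ spaceH ∧ IsProd q.1 q.2 (a, b)) ∧
    -- the factors come from the fixed point of a contraction on `𝓗`
    (eLpNorm (fun t => b t / a t) ∞ circMeas < 1 ∧
      (∃ K : ℝ≥0, ContractingWith K (fixedPointMap a b)) ∧
      ∃ A B : L2T,
        (∀ X : HilbPair, fixedPointMap a b X = X ↔ X = WithLp.toLp 2 (A, B)) ∧
        PosAtInfty A ∧
        ∀ am bm ap bp : L2T, (am, bm) ∈ spaceH0Star → (ap, bp) ∈ spaceH →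
          IsProd (am, bm) (ap, bp) (a, b) →
            ap = (((Real.sqrt (valInfty A).re)⁻¹ : ℝ) : ℂ) • A ∧
            bp = (((Real.sqrt (valInfty A).re)⁻¹ : ℝ) : ℂ) • B ∧
            IsProd (a, b) (star ap, -bp) (am, bm)) ∧
    -- existence and uniqueness of the sequence
    (∃! F : lp (fun _ : ℤ => ℂ) 2, IsNonlinearFourierSeries F (a, b)) := by
  obtain ⟨s, h⟩ := exists_isBPair hab
  have hK := h.contractingWith
  obtain ⟨A, B, hX⟩ : ∃ A B : L2T,
      ∀ X : HilbPair, fixedPointMap a b X = X ↔ X = WithLp.toLp 2 (A, B) := by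
    refine ⟨(hK.fixedPoint (fixedPointMap a b)).fst, (hK.fixedPoint (fixedPointMap a b)).snd,
      fun X => ⟨fun hX => hK.fixedPoint_unique hX, ?_⟩⟩
    rintro rfl
    exact hK.fixedPoint_isFixedPt
  have hAB : FixedEqs a b A B := (h.fixedPointMap_eq_iff A B).mp ((hX _).mpr rfl)
  obtain ⟨am, bm, ap, bp, hf⟩ := exists_isFactorization h hAB
  have hmem : ∀ am bm ap bp : L2T, (am, bm) ∈ spaceH0Star → (ap, bp) ∈ spaceH →
      IsProd (am, bm) (ap, bp) (a, b) → IsFactorization a b am bm ap bp :=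
    fun am bm ap bp h1 h2 h3 => isFactorization_of_mem h1.1 (mem_spaceH0Star_iff.mp h1).2.1 h2.1
      h2.2.1 h3
  have hprod : IsProd (am, bm) (ap, bp) (a, b) := isProd_iff.mpr ⟨hf.fst, hf.snd⟩
  refine ⟨⟨((am, bm), (ap, bp)), ⟨hf.mem_spaceH0Star h, hf.mem_spaceH h, hprod⟩, ?_⟩,
    ⟨h.eLpNorm_ratio_lt_one, ⟨_, hK⟩, A, B, hX, posAtInfty_iff.mpr hAB.posAtInfty, ?_⟩, ?_⟩
  · rintro ⟨⟨am', bm'⟩, ⟨ap', bp'⟩⟩ ⟨h1, h2, h3⟩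
    exact (hmem _ _ _ _ h1 h2 h3).unique h hf
  · intro am' bm' ap' bp' h1 h2 h3
    have hf' := hmem _ _ _ _ h1 h2 h3
    obtain ⟨e1, e2⟩ := hf'.eq_smul h fun X => (hX X).mp
    exact ⟨e1, e2, hf'.isProd⟩
  · obtain ⟨F, hF⟩ := exists_isNonlinearFourierSeries (hf.mem_spaceH0Star h) (hf.mem_spaceH h) hprod
    refine ⟨F, hF, fun F' hF' => ?_⟩
    obtain ⟨pm, pp, k1, k2, k3⟩ := hF
    obtain ⟨pm', pp', k1', k2', k3'⟩ := hF'
    -- Two sequences with the same series have the same left and right factors, so uniqueness can be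
    -- applied to each half separately.
    have e := (isFactorization_of_series k1 k2 k3).unique h (isFactorization_of_series k1' k2' k3')
    have e1 : pm = pm' := congrArg Prod.fst e
    have e2 : pp = pp' := congrArg Prod.snd e
    rw [← e1] at k1'
    rw [← e2] at k2'
    refine lp.ext (funext fun k => ?_)
    rcases lt_or_ge k 0 with hk | hk
    · exact k1'.unique k1 hk
    · obtain ⟨n, rfl⟩ := Int.eq_ofNat_of_zero_le hk
      exact k2'.unique k2 n
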